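/- Let $m\in\mathbb N$, let $x_1,\dots,x_m\in\mathbb R^3$ be pairwise distinct, put $r_j:=|x-x_j|$, and let $H$ be the minimal operator in $L^2(\mathbb R^3)$, $$H:=-\Delta,\qquad \operatorname{dom}(H):=\{f\in W^{2,2}(\mathbb R^3): f(x_j)=0,\ j=1,\dots,m\},$$ where $f(x_j)$ is the value of the continuous representative of $f$. For $z\in\mathbb C\setminus[0,\infty)$ let $\sqrt z$ be the square root with $\operatorname{Im}\sqrt z>0$, and let $\mathfrak N_z:=\ker(H^*-z)$ be the defect subspace. Then the following assertions hold. (i) $H$ is densely defined, closed and symmetric, with deficiency indices $n_\pm(H)=\dim\mathfrak N_{\pm i}=m$, and $$\mathfrak N_z=\Big\{\sum_{j=1}^m c_j\frac{e^{i\sqrt z\,r_j}}{4\pi r_j}: c_1,\dots,c_m\in\mathbb C\Big\},\qquad z\in\mathbb C\setminus[0,\infty).$$ (ii) The adjoint $H^*$ is given by $$\operatorname{dom}(H^*)=\Big\{f=\sum_{j=1}^m\Big(\xi_{0j}\frac{e^{-r_j}}{r_j}+\xi_{1j}e^{-r_j}\Big)+f_H:\ \xi_0,\xi_1\in\mathbb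 C^m,\ f_H\in\operatorname{dom}(H)\Big\},$$ $$H^*f=-\sum_{j=1}^m\Big(\xi_{0j}\frac{e^{-r_j}}{r_j}+\xi_{1j}\Big(e^{-r_j}-\frac{2e^{-r_j}}{r_j}\Big)\Big)-\Delta f_H .$$ (iii) Every $f\in\operatorname{dom}(H^*)$ has a representative that is continuous on $\mathbb R^3\setminus\{x_1,\dots,x_m\}$, and, with $f$ standing for this representative and $\xi_0$ for the coefficients in (ii), the limits $$\Gamma_0f:=4\pi\Big\{\lim_{x\to x_j}f(x)|x-x_j|\Big\}_{j=1}^m=4\pi\{\xi_{0j}\}_{j=1}^m,\qquad \Gamma_1f:=\Big\{\lim_{x\to x_j}\Big(f(x)-\frac{\xi_{0j}}{|x-x_j|}\Big)\Big\}_{j=1}^m$$ exist. The triple $\{\mathbb C^m,\Gamma_0,\Gamma_1\}$ is a boundary triplet for $H^*$, that is, $\Gamma_0,\Gamma_1:\operatorname{dom}(H^*)\to\mathbb C^m$ are linear, $(H^*f,g)-(f,H^*g)=(\Gamma_1f,\Gamma_0g)-(\Gamma_0f,\Gamma_1g)$ for all $f,g\in\operatorname{dom}(H^*)$, and $f\mapsto(\Gamma_0f,\Gamma_1f)$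 maps $\operatorname{dom}(H^*)$ onto $\mathbb C^m\oplus\mathbb C^m$. (iv) The operator $H_0:=H^*\upharpoonright\ker\Gamma_0$ is self-adjoint and coincides with the free Hamiltonian: $H_0=-\Delta$, $\operatorname{dom}(H_0)=W^{2,2}(\mathbb R^3)$. -/

import Mathlib

open MeasureTheory Filter Topology
open scoped LinearPMap SchwartzMap LineDeriv Laplacian ComplexConjugate

/-! ### Abstract extension theory -/

namespace Extension

variable {E : Type*} [NormedAddCommGroup E] [InnerProductSpace ℂ E] [CompleteSpace E]

/-- The defect subspace `𝔑_z(A) = ker (A* - z)` of a densely defined operator `A`. -/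
def defectSubspace (A : E →ₗ.[ℂ] E) (z : ℂ) : Submodule ℂ E where
  carrier := {f | ∃ h : f ∈ A†.domain, A† ⟨f, h⟩ = z • f}
  zero_mem' := ⟨A†.domain.zero_mem, by
    have h : A† (0 : A†.domain) = 0 := A†.map_zero
    rw [smul_zero]; exact h⟩
  add_mem' := by
    rintro f g ⟨hf, hf'⟩ ⟨hg, hg'⟩
    refine ⟨A†.domain.add_mem hf hg, ?_⟩
    have h := A†.map_add ⟨f, hf⟩ ⟨g, hg⟩
    rw [smul_add, ← hf', ← hg', ← h]; rfl
  smul_mem' := by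
    rintro c f ⟨hf, hf'⟩
    refine ⟨A†.domain.smul_mem c hf, ?_⟩
    have h := A†.map_smul c ⟨f, hf⟩
    rw [smul_comm, ← hf', ← h]; rfl

/-- The deficiency index `n₊(A) = dim 𝔑_i(A)`. -/
noncomputable def deficiencyIndexPlus (A : E →ₗ.[ℂ] E) : Cardinal :=
  Module.rank ℂ (defectSubspace A Complex.I)

/-- The deficiency index `n₋(A) = dim 𝔑_{-i}(A)`. -/
noncomputable def deficiencyIndexMinus (A : E →ₗ.[ℂ] E) : Cardinal :=
  Module.rank ℂ (defectSubspace A (-Complex.I))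

/-- A boundary triplet `{𝓗, Γ₀, Γ₁}` for the adjoint `A*`: linear maps `Γ₀, Γ₁ : dom A* → 𝓗` that
satisfy the abstract second Green identity and are such that `(Γ₀, Γ₁) : dom A* → 𝓗 ⊕ 𝓗` is onto.
(The identity is invariant under complex conjugation, so that it does not matter in which argument
the inner products are linear.) -/
structure BoundaryTriplet (A : E →ₗ.[ℂ] E) (K : Type*) [NormedAddCommGroup K]
    [InnerProductSpace ℂ K] [CompleteSpace K] where
  Γ₀ : A†.domain →ₗ[ℂ] K
  Γ₁ : A†.domain →ₗ[ℂ] K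
  green : ∀ f g : A†.domain,
    inner ℂ (A† f) (g : E) - inner ℂ (f : E) (A† g)
      = inner ℂ (Γ₁ f) (Γ₀ g) - inner ℂ (Γ₀ f) (Γ₁ g)
  surjective : Function.Surjective fun f : A†.domain ↦ (Γ₀ f, Γ₁ f)

/-- The extension `A₀ = A* ↾ ker Γ₀` associated with a boundary triplet. -/
noncomputable def BoundaryTriplet.A₀ {A : E →ₗ.[ℂ] E} {K : Type*} [NormedAddCommGroup K]
    [InnerProductSpace ℂ K] [CompleteSpace K] (T : BoundaryTriplet A K) : E →ₗ.[ℂ] E :=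
  A†.domRestrict (Submodule.map A†.domain.subtype (LinearMap.ker T.Γ₀))

end Extension

/-! ### The Schrödinger operator with point interactions in dimension three -/

namespace PointInteraction

/-- Euclidean space `ℝ³`. -/
abbrev R3 : Type := EuclideanSpace ℝ (Fin 3)

/-- The Hilbert space `L²(ℝ³)` of complex functions. -/
abbrev L2 : Type := Lp ℂ 2 (volume : Measure R3)

/-- The `L²` function `f` seen as a tempered distribution. -/
noncomputable abbrev toDistr (f : L2) : 𝓢'(R3, ℂ) := (f : 𝓢'(R3, ℂ))

lemma toDistr_add (f g : L2) : toDistr (f + g) = toDistr f + toDistr g :=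
  map_add (Lp.toTemperedDistributionCLM ℂ (volume : Measure R3) 2) f g

lemma toDistr_smul (c : ℂ) (f : L2) : toDistr (c • f) = c • toDistr f :=
  map_smul (Lp.toTemperedDistributionCLM ℂ (volume : Measure R3) 2) c f

lemma toDistr_zero : toDistr 0 = 0 :=
  map_zero (Lp.toTemperedDistributionCLM ℂ (volume : Measure R3) 2)

lemma toDistr_injective : Function.Injective toDistr :=
  LinearMap.ker_eq_bot.mp
    (Lp.ker_toTemperedDistributionCLM_eq_bot (F := ℂ) (μ := (volume : Measure R3)) (p := 2))

/-- The distributional partial derivative `∂_{i 0} ⋯ ∂_{i (n-1)} u`. -/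
noncomputable def partialD {n : ℕ} (i : Fin n → Fin 3) (u : 𝓢'(R3, ℂ)) : 𝓢'(R3, ℂ) :=
  ∂^{fun k ↦ (EuclideanSpace.single (i k) (1 : ℝ) : R3)} u

/-- The Sobolev space `W^{2,2}(ℝ³)`: all distributional partial derivatives of order at most two
are square integrable functions. -/
noncomputable def W22 : Submodule ℂ L2 where
  carrier := {f | ∀ n ≤ 2, ∀ i : Fin n → Fin 3, ∃ g : L2, partialD i (toDistr f) = toDistr g}
  zero_mem' n _ i := ⟨0, by
    rw [toDistr_zero]; exact LineDeriv.iteratedLineDerivOp_zero _⟩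
  add_mem' := by
    intro f g hf hg n hn i
    obtain ⟨f', hf'⟩ := hf n hn i
    obtain ⟨g', hg'⟩ := hg n hn i
    refine ⟨f' + g', ?_⟩
    rw [toDistr_add, toDistr_add, ← hf', ← hg']
    exact LineDeriv.iteratedLineDerivOp_add _ _ _
  smul_mem' := by
    intro c f hf n hn i
    obtain ⟨f', hf'⟩ := hf n hn i
    refine ⟨c • f', ?_⟩
    rw [toDistr_smul, toDistr_smul, ← hf']
    exact LineDeriv.iteratedLineDerivOp_smul _ _ _

lemma exists_neg_laplacian (f : W22) : ∃ g : L2, toDistr g = -Δ (toDistr f) := by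
  choose g hg using fun i : Fin 3 ↦ f.2 2 le_rfl (fun _ ↦ i)
  refine ⟨-∑ i, g i, ?_⟩
  have h : toDistr (-∑ i, g i) = -∑ i, toDistr (g i) := by
    have := map_neg (Lp.toTemperedDistributionCLM ℂ (volume : Measure R3) 2) (∑ i, g i)
    rw [map_sum] at this
    exact this
  rw [h, TemperedDistribution.laplacian_eq_sum (EuclideanSpace.basisFun (Fin 3) ℝ)]
  congr 1
  refine Finset.sum_congr rfl fun i _ ↦ ?_
  rw [← hg i]
  simp [partialD, EuclideanSpace.basisFun_apply]

/-- The free Hamiltonian `-Δ` with domain `W^{2,2}(ℝ³)`, where `Δ` is the distributional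
Laplacian. -/
noncomputable def freeHamiltonian : L2 →ₗ.[ℂ] L2 where
  domain := W22
  toFun :=
    { toFun := fun f ↦ (exists_neg_laplacian f).choose
      map_add' := by
        intro f g
        apply toDistr_injective
        rw [toDistr_add, (exists_neg_laplacian (f + g)).choose_spec,
          (exists_neg_laplacian f).choose_spec, (exists_neg_laplacian g).choose_spec,
          Submodule.coe_add, toDistr_add, ← neg_add,
          ← TemperedDistribution.laplacianCLM_apply, map_add]
        simp
      map_smul' := by
        intro c f
        apply toDistr_injective
        rw [RingHom.id_apply, toDistr_smul, (exists_neg_laplacian (c • f)).choose_spec,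
          (exists_neg_laplacian f).choose_spec, Submodule.coe_smul, toDistr_smul,
          ← TemperedDistribution.laplacianCLM_apply, map_smul]
        simp }

lemma toDistr_freeHamiltonian (f : freeHamiltonian.domain) :
    toDistr (freeHamiltonian f) = -Δ (toDistr f) :=
  (exists_neg_laplacian f).choose_spec

variable {m : ℕ}

/-- The classes `f ∈ L²(ℝ³)` that have a continuous representative vanishing at every `x j`. -/
noncomputable def vanishingAt (x : Fin m → R3) : Submodule ℂ L2 where
  carrier := {f | ∃ g : R3 → ℂ, Continuous g ∧ f =ᵐ[volume] g ∧ ∀ j, g (x j) = 0}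
  zero_mem' := ⟨0, continuous_zero, Lp.coeFn_zero _ _ _, fun _ ↦ rfl⟩
  add_mem' := by
    rintro f₁ f₂ ⟨g₁, hc₁, he₁, hx₁⟩ ⟨g₂, hc₂, he₂, hx₂⟩
    exact ⟨g₁ + g₂, hc₁.add hc₂, (Lp.coeFn_add _ _).trans (he₁.add he₂),
      fun j ↦ by simp [hx₁, hx₂]⟩
  smul_mem' := by
    rintro c f ⟨g, hc, he, hx⟩
    exact ⟨c • g, hc.const_smul c, (Lp.coeFn_smul _ _).trans (he.const_smul c),
      fun j ↦ by simp [hx]⟩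

/-- The minimal operator `H = -Δ`, `dom H = {f ∈ W^{2,2}(ℝ³) : f (x j) = 0 for all j}`. -/
noncomputable def minimalOperator (x : Fin m → R3) : L2 →ₗ.[ℂ] L2 :=
  freeHamiltonian.domRestrict (vanishingAt x)

/-- The branch of the square root on `ℂ ∖ [0, ∞)` with positive imaginary part; on `[0, ∞)` it takes
the boundary values from above, so that `√1 = 1`. -/
noncomputable def sqrtBranch (z : ℂ) : ℂ :=
  if 0 ≤ z.im then z ^ (1 / 2 : ℂ) else -z ^ (1 / 2 : ℂ)

/-- The function `∑ⱼ cⱼ e^{i √z rⱼ} / (4π rⱼ)`, where `rⱼ = |y - xⱼ|`. -/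
noncomputable def defectFunction (x : Fin m → R3) (z : ℂ) (c : Fin m → ℂ) (y : R3) : ℂ :=
  ∑ j, c j * (Complex.exp (Complex.I * sqrtBranch z * (‖y - x j‖ : ℂ))
    / (4 * (Real.pi : ℂ) * (‖y - x j‖ : ℂ)))

/-- The function `∑ⱼ (ξ₀ⱼ e^{-rⱼ} / rⱼ + ξ₁ⱼ e^{-rⱼ})`, where `rⱼ = |y - xⱼ|`. -/
noncomputable def expPart (x : Fin m → R3) (ξ₀ ξ₁ : Fin m → ℂ) (y : R3) : ℂ :=
  ∑ j, (ξ₀ j * ((Real.exp (-‖y - x j‖) / ‖y - x j‖ : ℝ) : ℂ)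
    + ξ₁ j * ((Real.exp (-‖y - x j‖) : ℝ) : ℂ))

/-- The function `-∑ⱼ (ξ₀ⱼ e^{-rⱼ} / rⱼ + ξ₁ⱼ (e^{-rⱼ} - 2 e^{-rⱼ} / rⱼ))`. -/
noncomputable def expPartImage (x : Fin m → R3) (ξ₀ ξ₁ : Fin m → ℂ) (y : R3) : ℂ :=
  -∑ j, (ξ₀ j * ((Real.exp (-‖y - x j‖) / ‖y - x j‖ : ℝ) : ℂ)
    + ξ₁ j * ((Real.exp (-‖y - x j‖) - 2 * Real.exp (-‖y - x j‖) / ‖y - x j‖ : ℝ) : ℂ))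

/-- `g` is a representative of the class `f` that is continuous off the points `x j`. Such a
representative is unique off these points; point values and limits of `f` are those of `g`. -/
def IsRegularRep (x : Fin m → R3) (f : L2) (g : R3 → ℂ) : Prop :=
  ContinuousOn g (Set.range x)ᶜ ∧ f =ᵐ[volume] g

end PointInteraction

/-!
The free Hamiltonian `A = -Δ` on `W^{2,2}(ℝ³)` is multiplication by `4π²|ξ|²` in Fourier space. Hence
it is symmetric, `A - z` is onto for `z ∉ [0, ∞)`, and `f ∈ W^{2,2}` has an integrable Fourier
transform, so that point evaluation is `f a = ∫ exp (2πi⟪ξ, a⟫) 𝓕 f ξ dξ`. A symmetric operator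
with `A + 1` onto is self-adjoint.

The function `exp (-k r) / (4π r)`, with `k² = -z` and `Re k > 0`, is the Green function of `-Δ - z`
(`integral_profile_mul_helmholtz`). This is proved by replacing `r` by `s = √(r² + ε²)`: the function
`exp (-k s) / s` is smooth, two integrations by parts are allowed, and `-Δ + k²` maps it to an
explicit function which, after rescaling by `ε`, is seen to be an approximate identity of mass `4π`.
It follows that the Fourier transform of the Green function is `exp (-2πi⟪ξ, a⟫) / (4π²|ξ|² - z)`,
and that the Green function represents `f ↦ f a` through `A - conj z` (`inner_greenL2`).
Differentiation in `k` at `k = 1` gives `(-Δ + 1) exp (-r) = 2 exp (-r) / r`.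

So the minimal operator `B` is the restriction of `A` to the vectors `f` with `(A + 1) f ⊥ G j`, where
`G j` is the Green function at `z = -1` with pole `x j`. The `G j` are linearly independent modulo
`dom A`, since functions in `W^{2,2}` are continuous and `G j` is singular at `x j` and nowhere else.
The rest is Hilbert space geometry (`Extension.IsFiniteRestriction`): `ker (B† - z)` is the orthogonal
complement of the range of `B - conj z`, which is spanned by the Green functions at `z`; every
`f ∈ dom B†` is uniquely `u + ∑ j, c j • G j` with `u ∈ dom A`; and `Γ₀ f = c`,
`Γ₁ f = u (x ·) + Q c` is a boundary triplet for any Hermitian `Q`. The matrix `Q` of regularised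
values of the Green functions makes `Γ₁ f` the vector of regular parts of `f`. Projecting `(A + 1) u`
onto the span of the `G j` splits `u` into a combination of the `(A + 1)⁻¹ G j = exp (-r j) / (8π)`
and a vector of `dom B`.
-/

/-! ### Restrictions of a self-adjoint operator by finitely many functionals -/

namespace Extension

variable {E : Type*} [NormedAddCommGroup E] [InnerProductSpace ℂ E]
variable {ι : Type*} [Fintype ι]

/-- A vector orthogonal to the common kernel of the functionals `⟪G j, ·⟫` is a linear combination
of the `G j`. -/
lemma exists_eq_sum_smul_of_inner_eq_zero (G : ι → E) {v : E}
    (hv : ∀ ψ : E, (∀ j, inner ℂ (G j) ψ = 0) → inner ℂ v ψ = 0) :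
    ∃ c : ι → ℂ, v = ∑ j, c j • G j := by
  set K := Submodule.span ℂ (Set.range G)
  have : FiniteDimensional ℂ K := FiniteDimensional.span_of_finite ℂ (Set.finite_range G)
  have hmem : v ∈ Kᗮᗮ := by
    rw [Submodule.mem_orthogonal']
    intro ψ hψ
    exact hv ψ fun j ↦
      (Submodule.mem_orthogonal K ψ).mp hψ _ (Submodule.subset_span (Set.mem_range_self j))
  rw [Submodule.orthogonal_orthogonal] at hmem
  obtain ⟨c, hc⟩ := (Submodule.mem_span_range_iff_exists_fun ℂ).mp hmem
  exact ⟨c, hc.symm⟩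

/-- Orthogonal projection onto the span of finitely many vectors. -/
lemma exists_sum_smul_add_orthogonal (G : ι → E) (v : E) :
    ∃ (c : ι → ℂ) (ψ : E), (∀ j, inner ℂ (G j) ψ = 0) ∧ v = ∑ j, c j • G j + ψ := by
  set K := Submodule.span ℂ (Set.range G)
  have : FiniteDimensional ℂ K := FiniteDimensional.span_of_finite ℂ (Set.finite_range G)
  obtain ⟨y, hy, ψ, hψ, h⟩ := K.exists_add_mem_mem_orthogonal v
  obtain ⟨c, hc⟩ := (Submodule.mem_span_range_iff_exists_fun ℂ).mp hy
  refine ⟨c, ψ, fun j ↦ ?_, by rw [hc, h]⟩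
  exact (Submodule.mem_orthogonal K ψ).mp hψ _ (Submodule.subset_span (Set.mem_range_self j))

/-- Linearly independent vectors `G j` admit `ψ` with prescribed values `⟪G j, ψ⟫`. -/
lemma exists_forall_inner_eq (G : ι → E) (hG : ∀ c : ι → ℂ, ∑ j, c j • G j = 0 → c = 0)
    (b : ι → ℂ) : ∃ ψ : E, ∀ j, inner ℂ (G j) ψ = b j := by
  let L : E →ₗ[ℂ] EuclideanSpace ℂ ι :=
    (WithLp.linearEquiv 2 ℂ (ι → ℂ)).symm.toLinearMap ∘ₗ
      LinearMap.pi fun j ↦ (innerₛₗ ℂ (G j))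
  have hL : ∀ ψ j, L ψ j = inner ℂ (G j) ψ := fun ψ j ↦ rfl
  have htop : LinearMap.range L = ⊤ := by
    rw [← Submodule.orthogonal_eq_bot_iff, Submodule.eq_bot_iff]
    intro c hc
    have h0 : ∑ j, c j • G j = 0 := by
      refine ext_inner_right ℂ fun ψ ↦ ?_
      have := (Submodule.mem_orthogonal' _ c).mp hc (L ψ) ⟨ψ, rfl⟩
      rw [PiLp.inner_apply] at this
      rw [inner_zero_left, sum_inner, ← this]
      refine Finset.sum_congr rfl fun j _ ↦ ?_
      rw [inner_smul_left, hL, RCLike.inner_apply]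
      ring
    have := hG _ h0
    ext j
    exact congrFun this j
  obtain ⟨ψ, hψ⟩ := (LinearMap.range_eq_top.mp htop) (WithLp.toLp 2 b)
  exact ⟨ψ, fun j ↦ by rw [← hL, hψ]⟩

/-- `B` is the restriction of the symmetric operator `A`, for which `A + 1` is onto, to the common
kernel of the functionals `f ↦ ⟪G j, (A + 1) f⟫`; the vectors `G j` are linearly independent modulo
the domain of `A`. -/
structure IsFiniteRestriction (A B : E →ₗ.[ℂ] E) (G : ι → E) : Prop where
  symm : A.IsFormalAdjoint A
  surj : ∀ ψ : E, ∃ u : A.domain, A u + (u : E) = ψ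
  le : B ≤ A
  mem_iff : ∀ f : A.domain, (f : E) ∈ B.domain ↔ ∀ j, inner ℂ (G j) (A f + (f : E)) = 0
  indep : ∀ c : ι → ℂ, ∑ j, c j • G j ∈ A.domain → c = 0

section SelfAdjoint

variable {A : E →ₗ.[ℂ] E}

lemma inner_add_one_symm (hA : A.IsFormalAdjoint A) (u v : A.domain) :
    inner ℂ (A u + (u : E)) (v : E) = inner ℂ (u : E) (A v + (v : E)) := by
  rw [inner_add_left, inner_add_right, hA u v]

lemma dense_domain_of_surjective_add_one (hA : A.IsFormalAdjoint A)
    (hs : ∀ ψ : E, ∃ u : A.domain, A u + (u : E) = ψ) [CompleteSpace E] :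
    Dense (A.domain : Set E) := by
  rw [Submodule.dense_iff_topologicalClosure_eq_top, Submodule.topologicalClosure_eq_top_iff,
    Submodule.eq_bot_iff]
  intro h hh
  obtain ⟨u, rfl⟩ := hs h
  have hu : (u : E) = 0 := by
    refine ext_inner_right ℂ fun ψ ↦ ?_
    obtain ⟨v, rfl⟩ := hs ψ
    rw [← inner_add_one_symm hA, inner_zero_left]
    exact (Submodule.mem_orthogonal' _ _).mp hh v v.2
  have : u = 0 := Subtype.ext hu
  rw [this, LinearPMap.map_zero]
  simp

/-- A symmetric operator `A` such that `A + 1` is onto is self-adjoint. -/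
lemma isSelfAdjoint_of_surjective_add_one (hA : A.IsFormalAdjoint A)
    (hs : ∀ ψ : E, ∃ u : A.domain, A u + (u : E) = ψ) [CompleteSpace E] :
    IsSelfAdjoint A := by
  have hd := dense_domain_of_surjective_add_one hA hs
  rw [LinearPMap.isSelfAdjoint_def]
  refine (LinearPMap.eq_of_le_of_domain_eq (hA.le_adjoint hd) ?_).symm
  refine le_antisymm (hA.le_adjoint hd).1 fun f hf ↦ ?_
  obtain ⟨u, hu⟩ := hs (A† ⟨f, hf⟩ + f)
  have : f = u := by
    refine ext_inner_right ℂ fun ψ ↦ ?_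
    obtain ⟨v, rfl⟩ := hs ψ
    rw [← inner_add_one_symm hA, hu, inner_add_left, inner_add_right,
      LinearPMap.adjoint_isFormalAdjoint hd ⟨f, hf⟩ v]
  rw [this]
  exact u.2

end SelfAdjoint

namespace IsFiniteRestriction

variable {A B : E →ₗ.[ℂ] E} {G : ι → E}

lemma apply_eq (h : IsFiniteRestriction A B G) (f : B.domain) :
    ∃ f' : A.domain, (f' : E) = f ∧ A f' = B f ∧ ∀ j, inner ℂ (G j) (B f + (f : E)) = 0 := by
  have hf' : A ⟨f, h.le.1 f.2⟩ = B f := (h.le.2 rfl).symm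
  refine ⟨⟨f, h.le.1 f.2⟩, rfl, hf', ?_⟩
  rw [← hf']
  exact (h.mem_iff ⟨f, h.le.1 f.2⟩).mp f.2

lemma exists_restrict (h : IsFiniteRestriction A B G) (f : A.domain)
    (hf : ∀ j, inner ℂ (G j) (A f + (f : E)) = 0) :
    ∃ f' : B.domain, (f' : E) = f ∧ B f' = A f :=
  ⟨⟨f, (h.mem_iff f).mpr hf⟩, rfl, h.le.2 rfl⟩

lemma isFormalAdjoint (h : IsFiniteRestriction A B G) : B.IsFormalAdjoint B := by
  intro f g
  obtain ⟨f', hf, hf', -⟩ := h.apply_eq f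
  obtain ⟨g', hg, hg', -⟩ := h.apply_eq g
  rw [← hf, ← hg, ← hf', ← hg', h.symm f' g']

lemma sum_smul_eq_zero (h : IsFiniteRestriction A B G) (c : ι → ℂ)
    (hc : ∑ j, c j • G j = 0) : c = 0 :=
  h.indep c (by rw [hc]; exact A.domain.zero_mem)

lemma decomposition_unique (h : IsFiniteRestriction A B G) {u v : A.domain} {c d : ι → ℂ}
    (he : (u : E) + ∑ j, c j • G j = (v : E) + ∑ j, d j • G j) : u = v ∧ c = d := by
  have hs : ∑ j, (c - d) j • G j = (v - u : A.domain) := by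
    simp only [Pi.sub_apply, sub_smul, Finset.sum_sub_distrib, Submodule.coe_sub]
    rw [sub_eq_sub_iff_add_eq_add, add_comm, he, add_comm]
  have hcd : c = d := sub_eq_zero.mp (h.indep _ (hs ▸ (v - u).2))
  subst hcd
  exact ⟨Subtype.ext (add_right_cancel he), rfl⟩

/-- Every vector of `dom A` is a combination of the `(A + 1)⁻¹ G j` plus a vector of `dom B`. -/
lemma exists_sum_add_restrict (h : IsFiniteRestriction A B G) (R : ι → A.domain)
    (hR : ∀ j, A (R j) + (R j : E) = G j) (u : A.domain) :
    ∃ (c : ι → ℂ) (w : B.domain), (u : E) = ∑ j, c j • (R j : E) + w := by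
  obtain ⟨c, ψ, hψ, hc⟩ := exists_sum_smul_add_orthogonal G (A u + (u : E))
  set w : A.domain := u - ∑ j, c j • R j
  have hw : A w + (w : E) = ψ := by
    have h1 : A (∑ j, c j • R j) = ∑ j, c j • A (R j) :=
      (map_sum A.toFun (fun j ↦ c j • R j) Finset.univ).trans
        (Finset.sum_congr rfl fun j _ ↦ A.map_smul (c j) (R j))
    have h2 : ∑ j, c j • G j = ∑ j, c j • A (R j) + ∑ j, c j • (R j : E) := by
      rw [← Finset.sum_add_distrib]
      simp only [← smul_add, hR]
    have h3 : (w : E) = u - ∑ j, c j • (R j : E) := by simp [w]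
    rw [LinearPMap.map_sub, h1, h3, ← add_sub_cancel_left (∑ j, c j • G j) ψ, ← hc, h2]
    abel
  refine ⟨c, ⟨w, (h.mem_iff w).mpr (by rw [hw]; exact hψ)⟩, ?_⟩
  simp [w]

variable [CompleteSpace E]

lemma dense_domain (h : IsFiniteRestriction A B G) : Dense (B.domain : Set E) := by
  rw [Submodule.dense_iff_topologicalClosure_eq_top, Submodule.topologicalClosure_eq_top_iff,
    Submodule.eq_bot_iff]
  intro v hv
  obtain ⟨u, rfl⟩ := h.surj v
  -- `u` is orthogonal to the range of `B + 1`, hence a combination of the `G j` in `dom A`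
  obtain ⟨c, hc⟩ := exists_eq_sum_smul_of_inner_eq_zero G (v := (u : E)) fun ψ hψ ↦ by
    obtain ⟨w, rfl⟩ := h.surj ψ
    rw [← inner_add_one_symm h.symm]
    exact (Submodule.mem_orthogonal' _ _).mp hv w ((h.mem_iff w).mpr hψ)
  have hc0 := h.indep c (hc ▸ u.2)
  have hu : u = 0 := Subtype.ext (by rw [hc, hc0]; simp)
  rw [hu, LinearPMap.map_zero]
  simp

lemma isSelfAdjoint (h : IsFiniteRestriction A B G) : IsSelfAdjoint A :=
  isSelfAdjoint_of_surjective_add_one h.symm h.surj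

lemma isClosed (h : IsFiniteRestriction A B G) : B.IsClosed := by
  have hA : A.IsClosed := h.isSelfAdjoint.isClosed
  have hgraph : (B.graph : Set (E × E)) =
      (A.graph : Set (E × E)) ∩ ⋂ j, {p | inner ℂ (G j) (p.2 + p.1) = 0} := by
    ext ⟨p, q⟩
    simp only [SetLike.mem_coe, LinearPMap.mem_graph_iff, Set.mem_inter_iff, Set.mem_iInter,
      Set.mem_ofPred_eq]
    constructor
    · rintro ⟨f, rfl, rfl⟩
      obtain ⟨f', hf, hf', h0⟩ := h.apply_eq f
      exact ⟨⟨f', hf, hf'⟩, h0⟩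
    · rintro ⟨⟨f, rfl, rfl⟩, h0⟩
      obtain ⟨f', hf, hf'⟩ := h.exists_restrict f h0
      exact ⟨f', hf, hf'⟩
  unfold LinearPMap.IsClosed at hA ⊢
  rw [hgraph]
  refine hA.inter (isClosed_iInter fun j ↦ isClosed_eq ?_ continuous_const)
  fun_prop

/-- The defect subspace of `B` at `z` is spanned by any vectors `Gz j` that represent the functionals
`f ↦ ⟪G j, (A + 1) f⟫` through `A - conj z`, since they span the orthogonal complement of the range
of `B - conj z`. -/
lemma mem_defectSubspace_iff (h : IsFiniteRestriction A B G) {z : ℂ} (Gz : ι → E)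
    (hs : ∀ ψ : E, ∃ u : A.domain, A u - conj z • (u : E) = ψ)
    (hGz : ∀ j (f : A.domain),
      inner ℂ (Gz j) (A f - conj z • (f : E)) = inner ℂ (G j) (A f + (f : E))) (f : E) :
    f ∈ defectSubspace B z ↔ ∃ c : ι → ℂ, f = ∑ j, c j • Gz j := by
  have hd := h.dense_domain
  constructor
  · rintro ⟨hf, hf'⟩
    refine exists_eq_sum_smul_of_inner_eq_zero Gz fun ψ hψ ↦ ?_
    obtain ⟨u, rfl⟩ := hs ψ
    obtain ⟨w, hw, hw'⟩ := h.exists_restrict u fun j ↦ by rw [← hGz, hψ]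
    have := LinearPMap.adjoint_isFormalAdjoint hd ⟨f, hf⟩ w
    rw [hf', inner_smul_left] at this
    rw [← hw, ← hw', inner_sub_right, ← this, inner_smul_right, sub_self]
  · rintro ⟨c, rfl⟩
    have key : ∀ w : B.domain, inner ℂ (z • ∑ j, c j • Gz j) (w : E)
        = inner ℂ (∑ j, c j • Gz j) (B w) := by
      intro w
      obtain ⟨u, hu, hu', h0⟩ := h.apply_eq w
      have h1 : inner ℂ (∑ j, c j • Gz j) (B w - conj z • (w : E)) = 0 := by
        rw [sum_inner]
        refine Finset.sum_eq_zero fun j _ ↦ ?_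
        rw [inner_smul_left, ← hu, ← hu', hGz, hu, hu', h0, mul_zero]
      rw [inner_sub_right, sub_eq_zero, inner_smul_right] at h1
      rw [h1, inner_smul_left]
    have hmem := LinearPMap.mem_adjoint_domain_of_exists _ ⟨_, key⟩
    exact ⟨hmem, LinearPMap.adjoint_apply_eq hd ⟨_, hmem⟩ key⟩

/-- The dimension of the defect subspace spanned by linearly independent vectors `Gz j`. -/
lemma rank_defectSubspace {z : ℂ} (Gz : ι → E)
    (hmem : ∀ f, f ∈ defectSubspace B z ↔ ∃ c : ι → ℂ, f = ∑ j, c j • Gz j)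
    (hind : ∀ c : ι → ℂ, ∑ j, c j • Gz j = 0 → c = 0) :
    Module.rank ℂ (defectSubspace B z) = Fintype.card ι := by
  have hspan : defectSubspace B z = Submodule.span ℂ (Set.range Gz) := by
    ext f
    rw [hmem, Submodule.mem_span_range_iff_exists_fun]
    exact exists_congr fun c ↦ eq_comm
  have hli : LinearIndependent ℂ Gz :=
    Fintype.linearIndependent_iff.mpr fun c hc j ↦ congrFun (hind c hc) j
  have : FiniteDimensional ℂ (Submodule.span ℂ (Set.range Gz)) :=
    FiniteDimensional.span_of_finite ℂ (Set.finite_range Gz)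
  rw [hspan, ← Module.finrank_eq_rank, finrank_span_eq_card hli]

lemma domain_le_adjoint (h : IsFiniteRestriction A B G) (u : A.domain) :
    ∃ hu : (u : E) ∈ B†.domain, B† ⟨u, hu⟩ = A u := by
  have key : ∀ w : B.domain, inner ℂ (A u) (w : E) = inner ℂ (u : E) (B w) := by
    intro w
    obtain ⟨w', hw, hw', -⟩ := h.apply_eq w
    rw [← hw, ← hw', h.symm u w']
  have hmem := LinearPMap.mem_adjoint_domain_of_exists _ ⟨_, key⟩
  exact ⟨hmem, LinearPMap.adjoint_apply_eq h.dense_domain ⟨_, hmem⟩ key⟩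

lemma sum_smul_mem_adjoint (h : IsFiniteRestriction A B G) (c : ι → ℂ) :
    ∃ hc : ∑ j, c j • G j ∈ B†.domain, B† ⟨_, hc⟩ = -∑ j, c j • G j := by
  obtain ⟨hc, hc'⟩ := (h.mem_defectSubspace_iff (z := -1) G (by simpa using h.surj) (by simp)
    (∑ j, c j • G j)).mpr ⟨c, rfl⟩
  exact ⟨hc, by simpa using hc'⟩

/-- The action of `B†` on a vector `u + ∑ j, c j • G j` with `u ∈ dom A`. -/
lemma add_sum_mem_adjoint (h : IsFiniteRestriction A B G) (u : A.domain) (c : ι → ℂ) :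
    ∃ hf : (u : E) + ∑ j, c j • G j ∈ B†.domain, B† ⟨_, hf⟩ = A u - ∑ j, c j • G j := by
  obtain ⟨hu, hu'⟩ := h.domain_le_adjoint u
  obtain ⟨hc, hc'⟩ := h.sum_smul_mem_adjoint c
  refine ⟨B†.domain.add_mem hu hc, ?_⟩
  rw [sub_eq_add_neg, ← hc', ← hu', ← LinearPMap.map_add]
  rfl

lemma adjoint_apply (h : IsFiniteRestriction A B G) (f : B†.domain) (u : A.domain) (c : ι → ℂ)
    (hf : (f : E) = (u : E) + ∑ j, c j • G j) : B† f = A u - ∑ j, c j • G j := by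
  obtain ⟨hf', hf''⟩ := h.add_sum_mem_adjoint u c
  rw [← hf'']
  congr 1
  exact Subtype.ext hf

/-- Decomposition of `dom B†` as `dom A` plus the defect subspace at `-1`. -/
lemma mem_adjoint_iff (h : IsFiniteRestriction A B G) (f : E) :
    f ∈ B†.domain ↔ ∃ (u : A.domain) (c : ι → ℂ), f = (u : E) + ∑ j, c j • G j := by
  constructor
  · intro hf
    obtain ⟨u, hu⟩ := h.surj (B† ⟨f, hf⟩ + f)
    obtain ⟨hu₁, hu₂⟩ := h.domain_le_adjoint u
    obtain ⟨c, hc⟩ := (h.mem_defectSubspace_iff (z := -1) G (by simpa using h.surj) (by simp)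
      (f - u)).mp ⟨B†.domain.sub_mem hf hu₁, by
        have := LinearPMap.map_sub B† ⟨f, hf⟩ ⟨u, hu₁⟩
        rw [neg_one_smul]
        refine this.trans ?_
        rw [hu₂, ← sub_eq_zero, eq_sub_of_add_eq hu]
        abel⟩
    exact ⟨u, c, by rw [← hc]; abel⟩
  · rintro ⟨u, c, rfl⟩
    exact (h.add_sum_mem_adjoint u c).1

/-- The parametrisation `(u, c) ↦ u + ∑ j, c j • G j` of `dom B†`. -/
noncomputable def adjointDomainEquiv (h : IsFiniteRestriction A B G) :
    (A.domain × (ι → ℂ)) ≃ₗ[ℂ] B†.domain :=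
  LinearEquiv.ofBijective
    { toFun := fun p ↦ ⟨(p.1 : E) + ∑ j, p.2 j • G j, (h.add_sum_mem_adjoint p.1 p.2).1⟩
      map_add' := fun p q ↦ Subtype.ext (by
        simp only [Prod.fst_add, Prod.snd_add, Pi.add_apply, add_smul, Finset.sum_add_distrib,
          Submodule.coe_add]
        abel)
      map_smul' := fun a p ↦ Subtype.ext (by
        simp only [Prod.smul_fst, Prod.smul_snd, Pi.smul_apply, smul_eq_mul, mul_smul,
          RingHom.id_apply, Submodule.coe_smul, smul_add, Finset.smul_sum]) }
    ⟨fun p q hpq ↦ by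
      obtain ⟨h1, h2⟩ := h.decomposition_unique (Subtype.ext_iff.mp hpq)
      exact Prod.ext h1 h2,
    fun f ↦ by
      obtain ⟨u, c, hf⟩ := (h.mem_adjoint_iff f).mp f.2
      exact ⟨(u, c), Subtype.ext hf.symm⟩⟩

lemma adjointDomainEquiv_symm_apply (h : IsFiniteRestriction A B G) (f : B†.domain)
    (u : A.domain) (c : ι → ℂ) (hf : (f : E) = (u : E) + ∑ j, c j • G j) :
    h.adjointDomainEquiv.symm f = (u, c) := by
  rw [LinearEquiv.symm_apply_eq]
  exact Subtype.ext hf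

/-- The linear map `(u, c) ↦ ⟪G j, (A + 1) u⟫ + ∑ i, Q j i * c i`. -/
noncomputable def boundaryValue (A : E →ₗ.[ℂ] E) (G : ι → E) (Q : ι → ι → ℂ) :
    (A.domain × (ι → ℂ)) →ₗ[ℂ] EuclideanSpace ℂ ι where
  toFun p := WithLp.toLp 2 fun j ↦ inner ℂ (G j) (A p.1 + (p.1 : E)) + ∑ i, Q j i * p.2 i
  map_add' p q := by
    ext j
    simp only [Prod.fst_add, Prod.snd_add, LinearPMap.map_add, Submodule.coe_add, Pi.add_apply,
      inner_add_right, mul_add, Finset.sum_add_distrib, PiLp.add_apply]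
    ring
  map_smul' a p := by
    ext j
    simp only [Prod.smul_fst, Prod.smul_snd, LinearPMap.map_smul, Submodule.coe_smul, Pi.smul_apply,
      inner_add_right, inner_smul_right, mul_add, PiLp.smul_apply, smul_eq_mul, RingHom.id_apply,
      Finset.mul_sum, mul_left_comm]

/-- The boundary triplet `Γ₀ f = c`, `Γ₁ f = ⟪G ·, (A + 1) u⟫ + Q c` for `f = u + ∑ j, c j • G j`.
The Hermitian matrix `Q` is free: it cancels in the Green identity. -/
noncomputable def boundaryTriplet (h : IsFiniteRestriction A B G) (Q : ι → ι → ℂ)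
    (hQ : ∀ i j, conj (Q i j) = Q j i) : BoundaryTriplet B (EuclideanSpace ℂ ι) where
  Γ₀ := (WithLp.linearEquiv 2 ℂ (ι → ℂ)).symm.toLinearMap ∘ₗ
    LinearMap.snd ℂ A.domain (ι → ℂ) ∘ₗ h.adjointDomainEquiv.symm.toLinearMap
  Γ₁ := boundaryValue A G Q ∘ₗ h.adjointDomainEquiv.symm.toLinearMap
  green f g := by
    obtain ⟨u, c, hf⟩ := (h.mem_adjoint_iff f).mp f.2
    obtain ⟨v, d, hg⟩ := (h.mem_adjoint_iff g).mp g.2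
    simp only [LinearMap.comp_apply, LinearEquiv.coe_coe,
      h.adjointDomainEquiv_symm_apply f u c hf, h.adjointDomainEquiv_symm_apply g v d hg,
      h.adjoint_apply f u c hf, h.adjoint_apply g v d hg, LinearMap.snd_apply, boundaryValue,
      LinearMap.coe_mk, AddHom.coe_mk, PiLp.inner_apply, RCLike.inner_apply,
      WithLp.linearEquiv_symm_apply]
    -- adding the identity to `B†` changes neither side and removes the defect vectors
    have e1 : inner ℂ (A u - ∑ j, c j • G j) (g : E) - inner ℂ (f : E) (A v - ∑ j, d j • G j)
        = inner ℂ (A u + (u : E)) (g : E) - inner ℂ (f : E) (A v + (v : E)) := by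
      have hu : A u - ∑ j, c j • G j = A u + (u : E) - f := by rw [hf]; abel
      have hv : A v - ∑ j, d j • G j = A v + (v : E) - g := by rw [hg]; abel
      rw [hu, hv, inner_sub_left, inner_sub_right]
      ring
    rw [e1, hf, hg, inner_add_right, inner_add_left (u : E), inner_add_one_symm h.symm,
      add_sub_add_left_eq_sub, inner_sum, sum_inner]
    have e2 : ∀ j, inner ℂ (A u + (u : E)) (d j • G j) =
        d j * conj (inner ℂ (G j) (A u + (u : E))) := fun j ↦ by
      rw [inner_smul_right, inner_conj_symm]
    simp only [e2, inner_smul_left, map_add, map_sum, map_mul, hQ, mul_add, add_mul,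
      Finset.sum_add_distrib, Finset.mul_sum, Finset.sum_mul]
    have e3 : ∑ j, ∑ i, d j * (Q i j * conj (c i)) = ∑ j, ∑ i, Q j i * d i * conj (c j) := by
      rw [Finset.sum_comm]
      exact Finset.sum_congr rfl fun j _ ↦ Finset.sum_congr rfl fun i _ ↦ by ring
    have e4 : ∀ (a : ι → ℂ) j, ((WithLp.addEquiv 2 (ι → ℂ)).invFun a).ofLp j = a j :=
      fun _ _ ↦ rfl
    simp only [e4]
    rw [e3, add_sub_add_right_eq_sub]
    congr 1
    exact Finset.sum_congr rfl fun j _ ↦ mul_comm _ _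
  surjective := by
    rintro ⟨a, b⟩
    obtain ⟨ψ, hψ⟩ := exists_forall_inner_eq G (fun c ↦ h.sum_smul_eq_zero c)
      fun j ↦ b j - ∑ i, Q j i * a i
    obtain ⟨u, rfl⟩ := h.surj ψ
    refine ⟨h.adjointDomainEquiv (u, fun i ↦ a i), ?_⟩
    simp only [LinearMap.comp_apply, LinearEquiv.coe_coe, LinearEquiv.symm_apply_apply]
    refine Prod.ext ?_ ?_
    · ext j; rfl
    · ext j
      simp only [boundaryValue, LinearMap.coe_mk, AddHom.coe_mk, hψ, sub_add_cancel]

section Triplet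

variable (h : IsFiniteRestriction A B G) (Q : ι → ι → ℂ) (hQ : ∀ i j, conj (Q i j) = Q j i)
  (f : B†.domain) (u : A.domain) (c : ι → ℂ) (hf : (f : E) = (u : E) + ∑ j, c j • G j)

include hf

lemma boundaryTriplet_Γ₀_apply (j : ι) : (h.boundaryTriplet Q hQ).Γ₀ f j = c j := by
  simp [boundaryTriplet, h.adjointDomainEquiv_symm_apply f u c hf]

lemma boundaryTriplet_Γ₁_apply (j : ι) : (h.boundaryTriplet Q hQ).Γ₁ f j =
    inner ℂ (G j) (A u + (u : E)) + ∑ i, Q j i * c i := by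
  simp [boundaryTriplet, h.adjointDomainEquiv_symm_apply f u c hf, boundaryValue]

end Triplet

/-- The extension `B† ↾ ker Γ₀` is the operator `A`. -/
lemma boundaryTriplet_A₀ (h : IsFiniteRestriction A B G) (Q : ι → ι → ℂ)
    (hQ : ∀ i j, conj (Q i j) = Q j i) : (h.boundaryTriplet Q hQ).A₀ = A := by
  symm
  refine LinearPMap.eq_of_le_of_domain_eq ⟨fun f hf ↦ ?_, fun u f huf ↦ ?_⟩ ?_
  · obtain ⟨hf', -⟩ := h.domain_le_adjoint ⟨f, hf⟩
    refine ⟨⟨⟨f, hf'⟩, ?_, rfl⟩, hf'⟩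
    ext j
    exact h.boundaryTriplet_Γ₀_apply Q hQ _ ⟨f, hf⟩ 0 (by simp) j
  · obtain ⟨hu, hu'⟩ := h.domain_le_adjoint u
    rw [← hu']
    exact (LinearPMap.domRestrict_apply huf.symm).symm
  · refine le_antisymm (fun f hf ↦ ?_) ?_
    · obtain ⟨hf', -⟩ := h.domain_le_adjoint ⟨f, hf⟩
      refine ⟨⟨⟨f, hf'⟩, ?_, rfl⟩, hf'⟩
      ext j
      exact h.boundaryTriplet_Γ₀_apply Q hQ _ ⟨f, hf⟩ 0 (by simp) j
    · rintro f ⟨⟨f', hf', rfl⟩, -⟩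
      obtain ⟨u, c, hc⟩ := (h.mem_adjoint_iff f').mp f'.2
      have hc0 : c = 0 := by
        ext j
        rw [← h.boundaryTriplet_Γ₀_apply Q hQ f' u c hc j]
        have := LinearMap.mem_ker.mp hf'
        rw [this]; rfl
      have : (f' : E) = u := by rw [hc, hc0]; simp
      rw [Submodule.coe_subtype, this]
      exact u.2

end IsFiniteRestriction

end Extension

/-! ### The free Hamiltonian in Fourier space -/

namespace PointInteraction

open FourierTransform TemperedDistribution
open scoped ContDiff

/-- Locally integrable functions are determined by their pairing with Schwartz functions. -/
lemma ae_eq_of_integral_schwartz_mul {u v : R3 → ℂ} (hu : LocallyIntegrable u)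
    (hv : LocallyIntegrable v) (h : ∀ χ : 𝓢(R3, ℂ), ∫ y, χ y * u y = ∫ y, χ y * v y) :
    u =ᵐ[volume] v := by
  refine ae_eq_of_integral_contDiff_smul_eq hu hv fun g hg hg' ↦ ?_
  have h₁ : HasCompactSupport (Complex.ofRealCLM ∘ g) := hg'.comp_left rfl
  have h₂ : ContDiff ℝ ∞ (Complex.ofRealCLM ∘ g) :=
    Complex.ofRealCLM.contDiff.comp hg
  simpa using h (h₁.toSchwartzMap h₂)

lemma toDistr_apply (f : L2) (χ : 𝓢(R3, ℂ)) : toDistr f χ = ∫ y, χ y * f y := by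
  simp [toDistr]

/-- The Fourier symbol `4π²|ξ|²` of `-Δ`. -/
noncomputable def symbol (ξ : R3) : ℂ := ((2 * Real.pi) ^ 2 * ‖ξ‖ ^ 2 : ℝ)

lemma continuous_symbol : Continuous symbol := by
  unfold symbol; fun_prop

lemma locallyIntegrable_L2 (f : L2) : LocallyIntegrable f :=
  (Lp.memLp f).locallyIntegrable (by norm_num)

lemma locallyIntegrable_continuous_mul {p : R3 → ℂ} (hp : Continuous p) {u : R3 → ℂ}
    (hu : LocallyIntegrable u) : LocallyIntegrable fun ξ ↦ p ξ * u ξ := by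
  rw [← locallyIntegrableOn_univ] at hu ⊢
  exact hu.continuousOn_mul hp.continuousOn isOpen_univ.isLocallyClosed

lemma hasTemperateGrowth_normSq : (fun ξ : R3 ↦ Complex.ofReal (‖ξ‖ ^ 2)).HasTemperateGrowth := by
  fun_prop

/-- The Fourier transform of `-Δ u` is multiplication by the symbol. -/
lemma fourier_neg_laplacian_apply (u : L2) (χ : 𝓢(R3, ℂ)) :
    𝓕 (-Δ (toDistr u)) χ = ∫ ξ, χ ξ * (symbol ξ * (𝓕 u : L2) ξ) := by
  have e : 𝓕 (-Δ (toDistr u)) = ((2 * Real.pi) ^ 2 : ℝ) •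
      smulLeftCLM ℂ (fun ξ : R3 ↦ Complex.ofReal (‖ξ‖ ^ 2)) (toDistr (𝓕 u)) := by
    rw [laplacian_eq_fourierMultiplierCLM, neg_smul, neg_neg, fourierMultiplierCLM_apply,
      toDistr, toDistr, ← Lp.fourier_toTemperedDistribution_eq, ← Complex.coe_smul,
      FourierTransform.fourier_smul, FourierTransform.fourier_fourierInv_eq]
    rfl
  have e' := DFunLike.congr_fun e χ
  rw [e']
  change (((2 * Real.pi) ^ 2 : ℝ) : ℂ) • (smulLeftCLM ℂ (fun ξ : R3 ↦ Complex.ofReal (‖ξ‖ ^ 2))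
    (toDistr (𝓕 u)) χ) = _
  simp only [smulLeftCLM_apply_apply, toDistr_apply, smul_eq_mul]
  rw [← integral_const_mul]
  refine integral_congr_ae (.of_forall fun ξ ↦ ?_)
  simp only [SchwartzMap.smulLeftCLM_apply_apply hasTemperateGrowth_normSq, symbol, smul_eq_mul]
  push_cast
  ring

/-- The relation `w = -Δ u` between `L²` functions, in Fourier space. -/
lemma toDistr_eq_neg_laplacian_iff (u w : L2) :
    toDistr w = -Δ (toDistr u) ↔
      (𝓕 w : L2) =ᵐ[volume] fun ξ ↦ symbol ξ * (𝓕 u : L2) ξ := by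
  have hF : 𝓕 (toDistr w) = toDistr (𝓕 w) := Lp.fourier_toTemperedDistribution_eq w
  constructor
  · intro h
    refine ae_eq_of_integral_schwartz_mul (locallyIntegrable_L2 _)
      (locallyIntegrable_continuous_mul continuous_symbol (locallyIntegrable_L2 _)) fun χ ↦ ?_
    rw [← fourier_neg_laplacian_apply, ← h, hF, toDistr_apply]
  · intro h
    have : 𝓕 (toDistr w) = 𝓕 (-Δ (toDistr u)) := by
      ext χ
      rw [fourier_neg_laplacian_apply, hF, toDistr_apply]
      refine integral_congr_ae ?_
      filter_upwards [h] with ξ hξ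
      rw [hξ]
    have := congrArg 𝓕⁻ this
    rwa [FourierTransform.fourierInv_fourier_eq, FourierTransform.fourierInv_fourier_eq] at this

/-- Elliptic regularity: an `L²` function with `L²` Laplacian is in the Sobolev space of order two. -/
lemma memSobolev_two {f g : L2} (h : toDistr g = -Δ (toDistr f)) :
    MemSobolev 2 2 (toDistr f) := by
  refine ⟨f + (((2 * Real.pi) ^ 2)⁻¹ : ℂ) • g, ?_⟩
  change _ = toDistr _
  rw [toDistr_add, toDistr_smul, h, laplacian_eq_fourierMultiplierCLM, besselPotential]
  have e : (fun x : R3 ↦ (((1 + ‖x‖ ^ 2) ^ ((2 : ℝ) / 2) : ℝ) : ℂ)) =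
      fun x ↦ ∑ i : Fin 2, (![fun _ ↦ 1, fun x : R3 ↦ Complex.ofReal (‖x‖ ^ 2)] i) x := by
    ext x
    simp
  rw [e, fourierMultiplierCLM_sum ℂ (s := Finset.univ)]
  · have hpi : ((2 * Real.pi : ℂ) ^ 2) ≠ 0 := by simp [Real.pi_ne_zero]
    simp only [Fin.sum_univ_two, Matrix.cons_val_zero, Matrix.cons_val_one, neg_smul, neg_neg,
      fourierMultiplierCLM_const, one_smul]
    rw [← Complex.coe_smul, smul_smul]
    push_cast
    rw [inv_mul_cancel₀ hpi, one_smul]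
    rfl
  · intro i _
    fin_cases i
    · exact Function.HasTemperateGrowth.const 1
    · exact hasTemperateGrowth_normSq

lemma memSobolev_partialD {n : ℕ} (i : Fin n → Fin 3) {s : ℝ} {u : 𝓢'(R3, ℂ)}
    (hu : MemSobolev s 2 u) : MemSobolev (s - n) 2 (partialD i u) := by
  induction n with
  | zero => simpa using! hu
  | succ n ih =>
    have := (ih (Fin.tail i)).lineDerivOp (m := EuclideanSpace.single (i 0) (1 : ℝ))
    push_cast
    rw [← sub_sub]
    exact this

lemma mem_W22_iff (f : L2) : f ∈ W22 ↔ ∃ g : L2, toDistr g = -Δ (toDistr f) := by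
  refine ⟨fun hf ↦ exists_neg_laplacian ⟨f, hf⟩, fun ⟨g, hg⟩ n hn i ↦ ?_⟩
  have h1 := memSobolev_partialD i (memSobolev_two hg)
  have h2 := h1.mono (s' := 0) (by
    have : (n : ℝ) ≤ 2 := by exact_mod_cast hn
    linarith)
  exact memSobolev_zero_iff.mp h2

lemma exists_freeHamiltonian {f g : L2} (h : toDistr g = -Δ (toDistr f)) :
    ∃ hf : f ∈ freeHamiltonian.domain, freeHamiltonian ⟨f, hf⟩ = g := by
  refine ⟨(mem_W22_iff f).mpr ⟨g, h⟩, toDistr_injective ?_⟩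
  rw [toDistr_freeHamiltonian, h]

lemma fourier_freeHamiltonian (f : freeHamiltonian.domain) :
    (𝓕 (freeHamiltonian f) : L2) =ᵐ[volume] fun ξ ↦ symbol ξ * (𝓕 (f : L2) : L2) ξ :=
  (toDistr_eq_neg_laplacian_iff _ _).mp (toDistr_freeHamiltonian f)

lemma freeHamiltonian_isFormalAdjoint : freeHamiltonian.IsFormalAdjoint freeHamiltonian := by
  intro f g
  rw [← Lp.inner_fourier_eq, ← Lp.inner_fourier_eq (f : L2), L2.inner_def, L2.inner_def]
  refine integral_congr_ae ?_
  filter_upwards [fourier_freeHamiltonian f, fourier_freeHamiltonian g] with ξ h1 h2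
  rw [h1, h2]
  simp only [RCLike.inner_apply, map_mul, symbol, Complex.conj_ofReal]
  ring

/-- The distance of `z ∉ [0, ∞)` from the values of the symbol is bounded below. -/
lemma exists_norm_symbol_sub_ge {z : ℂ} (hz : z ∉ Complex.ofReal '' Set.Ici (0 : ℝ)) :
    ∃ δ > 0, ∀ ξ, δ ≤ ‖symbol ξ - z‖ := by
  have hcl : IsClosed (Complex.ofReal '' Set.Ici (0 : ℝ)) :=
    Complex.isometry_ofReal.isClosedEmbedding.isClosedMap _ isClosed_Ici
  obtain ⟨δ, hδ, hball⟩ := Metric.isOpen_iff.mp hcl.isOpen_compl z hz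
  refine ⟨δ, hδ, fun ξ ↦ ?_⟩
  by_contra! hlt
  exact hball (Metric.mem_ball.mpr (by rwa [dist_eq_norm])) ⟨_, by
    simp only [Set.mem_Ici]; positivity, rfl⟩

lemma symbol_sub_ne_zero {z : ℂ} (hz : z ∉ Complex.ofReal '' Set.Ici (0 : ℝ)) (ξ : R3) :
    symbol ξ - z ≠ 0 := by
  obtain ⟨δ, hδ, h⟩ := exists_norm_symbol_sub_ge hz
  intro h0
  have := h ξ
  rw [h0, norm_zero] at this
  linarith

lemma surjective_freeHamiltonian_sub {z : ℂ} (hz : z ∉ Complex.ofReal '' Set.Ici (0 : ℝ)) (ψ : L2) :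
    ∃ u : freeHamiltonian.domain, freeHamiltonian u - z • (u : L2) = ψ := by
  obtain ⟨δ, hδ, hge⟩ := exists_norm_symbol_sub_ge hz
  have hne := symbol_sub_ne_zero hz
  have hcont : Continuous fun ξ ↦ (symbol ξ - z)⁻¹ :=
    (continuous_symbol.sub continuous_const).inv₀ hne
  have hmem : MemLp (fun ξ ↦ (symbol ξ - z)⁻¹ * (𝓕 ψ : L2) ξ) 2 volume := by
    refine (Lp.memLp (𝓕 ψ)).of_le_mul (c := δ⁻¹)
      (hcont.aestronglyMeasurable.mul (Lp.memLp _).1) (.of_forall fun ξ ↦ ?_)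
    rw [norm_mul, norm_inv]
    gcongr
    exact hge ξ
  set u : L2 := 𝓕⁻ (hmem.toLp _)
  have hu : (𝓕 u : L2) =ᵐ[volume] fun ξ ↦ (symbol ξ - z)⁻¹ * (𝓕 ψ : L2) ξ := by
    rw [show (𝓕 u : L2) = hmem.toLp _ from FourierTransform.fourier_fourierInv_eq _]
    exact hmem.coeFn_toLp
  have hw : toDistr (ψ + z • u) = -Δ (toDistr u) := by
    rw [toDistr_eq_neg_laplacian_iff, FourierTransform.fourier_add, FourierTransform.fourier_smul]
    filter_upwards [hu, Lp.coeFn_add (𝓕 ψ) (z • 𝓕 u), Lp.coeFn_smul z (𝓕 u)] with ξ h1 h2 h3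
    rw [h2, Pi.add_apply, h3, Pi.smul_apply, h1, smul_eq_mul]
    have := hne ξ
    field_simp
    ring
  obtain ⟨hu', hu''⟩ := exists_freeHamiltonian hw
  exact ⟨⟨u, hu'⟩, by rw [hu'']; simp⟩

/-! ### Continuity of functions in the Sobolev space -/

lemma integrable_fourier {f : L2} (hf : f ∈ W22) : Integrable (𝓕 f : L2) := by
  obtain ⟨g, hg⟩ := (mem_W22_iff f).mp hf
  obtain ⟨v, hv⟩ := (memSobolev_two hg).fourier_memL1 (by simp; norm_num)
  have hv1 : Integrable v := memLp_one_iff_integrable.mp (Lp.memLp v)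
  refine hv1.congr ?_
  refine ae_eq_of_integral_schwartz_mul hv1.locallyIntegrable (locallyIntegrable_L2 _) fun χ ↦ ?_
  rw [← toDistr_apply]
  have : toDistr (𝓕 f) = 𝓕 (toDistr f) := (Lp.fourier_toTemperedDistribution_eq f).symm
  rw [this, hv]
  simp

/-- The continuous representative of `f ∈ W^{2,2}(ℝ³)`, given by Fourier inversion. -/
noncomputable def contRep (f : L2) : R3 → ℂ := 𝓕⁻ ((𝓕 f : L2) : R3 → ℂ)

lemma contRep_apply (f : L2) (a : R3) :
    contRep f a = ∫ ξ, Complex.exp (↑(2 * Real.pi * inner ℝ ξ a) * Complex.I) * (𝓕 f : L2) ξ := by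
  rw [contRep, Real.fourierInv_eq']
  rfl

lemma continuous_contRep {f : L2} (hf : f ∈ W22) : Continuous (contRep f) := by
  refine VectorFourier.fourierIntegral_continuous Real.continuous_fourierChar (L := -innerₗ R3) ?_
    (integrable_fourier hf)
  simp only [LinearMap.neg_apply, innerₗ_apply_apply]
  fun_prop

lemma ae_eq_contRep {f : L2} (hf : f ∈ W22) : f =ᵐ[volume] contRep f := by
  refine ae_eq_of_integral_schwartz_mul (locallyIntegrable_L2 f)
    (continuous_contRep hf).locallyIntegrable fun χ ↦ ?_
  rw [← toDistr_apply]
  have h1 : toDistr f = 𝓕⁻ (toDistr (𝓕 f)) := by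
    rw [toDistr, toDistr, ← Lp.fourier_toTemperedDistribution_eq,
      FourierTransform.fourierInv_fourier_eq]
  rw [h1, fourierInv_apply, toDistr_apply]
  have h2 := VectorFourier.integral_bilin_fourierIntegral_eq_flip (μ := volume) (ν := volume)
    (ContinuousLinearMap.mul ℂ ℂ) (L := -innerₗ R3) (f := χ) (g := ((𝓕 f : L2) : R3 → ℂ))
    Real.continuous_fourierChar (by simp only [LinearMap.neg_apply, innerₗ_apply_apply]; fun_prop)
    χ.integrable (integrable_fourier hf)
  have h3 : (-innerₗ R3).flip = -innerₗ R3 := by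
    ext x y
    simp [real_inner_comm]
  rw [h3] at h2
  rw [SchwartzMap.fourierInv_coe]
  exact h2

lemma contRep_eq_of_ae_eq {f : L2} (hf : f ∈ W22) {g : R3 → ℂ} (hg : Continuous g)
    (h : f =ᵐ[volume] g) : contRep f = g :=
  (continuous_contRep hf).ae_eq_iff_eq volume hg |>.mp ((ae_eq_contRep hf).symm.trans h)

lemma mem_vanishingAt_iff {m : ℕ} (x : Fin m → R3) {f : L2} (hf : f ∈ W22) :
    f ∈ vanishingAt x ↔ ∀ j, contRep f (x j) = 0 := by
  constructor
  · rintro ⟨g, hg, he, hx⟩ j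
    rw [contRep_eq_of_ae_eq hf hg he, hx]
  · exact fun h ↦ ⟨contRep f, continuous_contRep hf, ae_eq_contRep hf, h⟩

/-- Point evaluation on `W^{2,2}(ℝ³)` is represented through `-Δ - conj z` by the `L²` function with
Fourier transform `exp (-2πi⟪ξ, a⟫) / (4π²|ξ|² - z)`. -/
lemma inner_freeHamiltonian_sub {z : ℂ} (g : L2) (a : R3)
    (hg : (fun ξ ↦ (symbol ξ - z) * (𝓕 g : L2) ξ) =ᵐ[volume]
      fun ξ ↦ Complex.exp (-(↑(2 * Real.pi * inner ℝ ξ a) * Complex.I)))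
    (f : freeHamiltonian.domain) :
    inner ℂ g (freeHamiltonian f - conj z • (f : L2)) = contRep f a := by
  rw [← Lp.inner_fourier_eq, L2.inner_def, contRep_apply]
  refine integral_congr_ae ?_
  have hsub : 𝓕 (freeHamiltonian f - conj z • (f : L2)) =
      𝓕 (freeHamiltonian f) - conj z • 𝓕 (f : L2) := by
    rw [sub_eq_add_neg, ← neg_smul, FourierTransform.fourier_add, FourierTransform.fourier_smul,
      neg_smul, sub_eq_add_neg]
  rw [hsub]
  filter_upwards [hg, fourier_freeHamiltonian f, Lp.coeFn_sub (𝓕 (freeHamiltonian f))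
    (conj z • 𝓕 (f : L2)), Lp.coeFn_smul (conj z) (𝓕 (f : L2))] with ξ h1 h2 h3 h4
  have h5 := congrArg conj h1
  rw [← Complex.exp_conj] at h5
  simp only [map_mul, map_sub, map_neg, Complex.conj_ofReal, Complex.conj_I, mul_neg, neg_neg,
    symbol] at h5
  rw [h3, Pi.sub_apply, h4, Pi.smul_apply, h2, RCLike.inner_apply, ← h5, symbol, smul_eq_mul]
  ring

end PointInteraction

/-! ### Radial integrals in dimension three -/

namespace PointInteraction

lemma integrable_exp_neg_mul_norm_sub_div_pow {κ : ℝ} (hκ : 0 < κ) {n : ℕ} (hn : n ≤ 2) (a : R3) :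
    Integrable fun y : R3 ↦ Real.exp (-κ * ‖y - a‖) / ‖y - a‖ ^ n := by
  refine Integrable.comp_sub_right (f := fun y : R3 ↦ Real.exp (-κ * ‖y‖) / ‖y‖ ^ n) ?_ a
  rw [integrable_fun_norm_addHaar volume (f := fun r : ℝ ↦ Real.exp (-κ * r) / r ^ n)]
  have h := integrableOn_rpow_mul_exp_neg_mul_rpow (p := 1) (s := ((2 - n : ℕ) : ℝ))
    (lt_of_lt_of_le (by norm_num) (Nat.cast_nonneg _)) one_pos hκ
  refine h.congr_fun (fun r hr ↦ ?_) measurableSet_Ioi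
  have hr' : r ≠ 0 := ne_of_gt hr
  have e : r ^ 2 = r ^ (2 - n) * r ^ n := by rw [← pow_add, Nat.sub_add_cancel hn]
  simp only [finrank_euclideanSpace, Fintype.card_fin, Nat.add_one_sub_one, smul_eq_mul,
    Real.rpow_natCast, Real.rpow_one]
  rw [e]
  field_simp

lemma tendsto_div_sqrt_one_add_sq :
    Tendsto (fun r : ℝ ↦ r / √(1 + r ^ 2)) atTop (𝓝 1) := by
  have h : Tendsto (fun r : ℝ ↦ (√((r ^ 2)⁻¹ + 1))⁻¹) atTop (𝓝 (√(0 + 1))⁻¹) := by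
    refine Tendsto.inv₀ (Tendsto.sqrt (Tendsto.add_const 1 ?_)) (by simp)
    exact (tendsto_pow_atTop two_ne_zero).inv_tendsto_atTop
  simp only [zero_add, Real.sqrt_one, inv_one] at h
  refine h.congr' ?_
  filter_upwards [eventually_gt_atTop 0] with r hr
  have e : (r ^ 2)⁻¹ + 1 = (1 + r ^ 2) / r ^ 2 := by field_simp
  rw [e, Real.sqrt_div (by positivity), Real.sqrt_sq hr.le, inv_div]

lemma hasDerivAt_div_sqrt_one_add_sq_pow_three (r : ℝ) :
    HasDerivAt (fun r : ℝ ↦ (r / √(1 + r ^ 2)) ^ 3) (r ^ 2 * (3 / √(1 + r ^ 2) ^ 5)) r := by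
  have hpos : 0 < 1 + r ^ 2 := by positivity
  have hs : HasDerivAt (fun r : ℝ ↦ √(1 + r ^ 2)) (r / √(1 + r ^ 2)) r := by
    have := ((hasDerivAt_pow 2 r).const_add 1).sqrt hpos.ne'
    refine this.congr_deriv ?_
    field_simp
    simp
  have hsq : √(1 + r ^ 2) ^ 2 = 1 + r ^ 2 := Real.sq_sqrt hpos.le
  have hσ : √(1 + r ^ 2) ≠ 0 := (Real.sqrt_pos.mpr hpos).ne'
  refine (((hasDerivAt_id r).div hs hσ).pow 3).congr_deriv ?_
  simp only [Pi.div_apply, id_eq, Nat.cast_ofNat, Nat.add_one_sub_one, one_mul]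
  field_simp
  rw [hsq]
  ring

/-- The profile `3 (1 + |y|²)^(-5/2)` of the approximate identity has total mass `4π`. -/
lemma integrable_and_integral_three_div_sqrt_pow_five :
    Integrable (fun y : R3 ↦ 3 / √(1 + ‖y‖ ^ 2) ^ 5) ∧
      ∫ y : R3, 3 / √(1 + ‖y‖ ^ 2) ^ 5 = 4 * Real.pi := by
  have hnn : ∀ r ∈ Set.Ioi (0 : ℝ), 0 ≤ r ^ 2 * (3 / √(1 + r ^ 2) ^ 5) := fun r _ ↦ by positivity
  have hl : Tendsto (fun r : ℝ ↦ (r / √(1 + r ^ 2)) ^ 3) atTop (𝓝 1) := by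
    simpa using tendsto_div_sqrt_one_add_sq.pow 3
  have hd := fun r (_ : r ∈ Set.Ici (0 : ℝ)) ↦ hasDerivAt_div_sqrt_one_add_sq_pow_three r
  have h1 := integrableOn_Ioi_deriv_of_nonneg' hd hnn hl
  have h2 := integral_Ioi_of_hasDerivAt_of_nonneg' hd hnn hl
  constructor
  · rw [integrable_fun_norm_addHaar volume (f := fun r : ℝ ↦ 3 / √(1 + r ^ 2) ^ 5)]
    simpa using h1
  · rw [integral_fun_norm_addHaar volume (fun r : ℝ ↦ 3 / √(1 + r ^ 2) ^ 5)]
    simp only [finrank_euclideanSpace, Fintype.card_fin, Nat.add_one_sub_one, smul_eq_mul, h2,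
      Measure.real, EuclideanSpace.volume_ball_fin_three]
    rw [ENNReal.toReal_mul, ENNReal.toReal_pow, ENNReal.toReal_ofReal (by norm_num),
      ENNReal.toReal_ofReal (by positivity)]
    simp
    ring

/-! ### The Green function of the Helmholtz operator -/

/-- The smoothed distance `√(|y - a|² + ε²)`. -/
noncomputable def softDist (ε : ℝ) (a y : R3) : ℝ := √(‖y - a‖ ^ 2 + ε ^ 2)

section SoftDist

variable {ε : ℝ} (hε : 0 < ε) (a y : R3)

lemma continuous_softDist (ε : ℝ) (a : R3) : Continuous (softDist ε a) := by
  unfold softDist; fun_prop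

lemma softDist_sq (ε : ℝ) (a y : R3) : softDist ε a y ^ 2 = ‖y - a‖ ^ 2 + ε ^ 2 :=
  Real.sq_sqrt (by positivity)

lemma norm_sub_le_softDist (ε : ℝ) (a y : R3) : ‖y - a‖ ≤ softDist ε a y :=
  Real.le_sqrt_of_sq_le (le_add_of_nonneg_right (sq_nonneg ε))

lemma le_softDist : ε ≤ softDist ε a y :=
  Real.le_sqrt_of_sq_le (le_add_of_nonneg_left (sq_nonneg _))

include hε in
lemma softDist_pos : 0 < softDist ε a y := hε.trans_le (le_softDist a y)

include hε in
lemma hasLineDerivAt_softDist (i : Fin 3) :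
    HasLineDerivAt ℝ (softDist ε a) ((y - a) i / softDist ε a y) y
      (EuclideanSpace.single i (1 : ℝ)) := by
  have h1 : HasFDerivAt (fun y : R3 ↦ ‖y - a‖ ^ 2 + ε ^ 2) _ y :=
    (((hasFDerivAt_id y).sub_const a).norm_sq).add_const (ε ^ 2)
  have h2 := (h1.sqrt (by positivity)).hasLineDerivAt (EuclideanSpace.single i (1 : ℝ))
  have hne : √(‖y - a‖ ^ 2 + ε ^ 2) ≠ 0 := (softDist_pos hε a y).ne'
  simp only [smul_apply, ContinuousLinearMap.comp_apply, id_eq,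
    ContinuousLinearMap.id_apply, innerSL_apply_apply, EuclideanSpace.inner_single_right,
    nsmul_eq_mul, smul_eq_mul] at h2
  have e : (y - a) i / softDist ε a y = 1 / (2 * √(‖y - a‖ ^ 2 + ε ^ 2)) *
      (((2 : ℕ) : ℝ) * (1 * conj ((y - a) i))) := by
    simp only [softDist, Nat.cast_ofNat, conj_trivial]
    field_simp
  rw [e]
  exact h2

include hε in
/-- Chain rule for radial functions. -/
lemma hasLineDerivAt_comp_softDist {P P' : ℝ → ℂ}
    (hP : ∀ s > 0, HasDerivAt P (P' s) s) (i : Fin 3) :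
    HasLineDerivAt ℝ (fun y ↦ P (softDist ε a y))
      (((y - a) i / softDist ε a y : ℝ) * P' (softDist ε a y)) y
      (EuclideanSpace.single i (1 : ℝ)) := by
  have h1 := hasLineDerivAt_softDist hε a y i
  have h2 := hP _ (softDist_pos hε a y)
  unfold HasLineDerivAt at h1 ⊢
  have h3 : HasDerivAt P (P' (softDist ε a y))
      (softDist ε a (y + (0 : ℝ) • EuclideanSpace.single i (1 : ℝ))) := by simpa using h2
  have := h3.scomp (0 : ℝ) h1
  rw [Complex.real_smul] at this
  exact this

lemma hasLineDerivAt_coord (i : Fin 3) :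
    HasLineDerivAt ℝ (fun y : R3 ↦ ((y - a) i : ℂ)) 1 y (EuclideanSpace.single i (1 : ℝ)) := by
  have h : HasDerivAt (fun t : ℝ ↦ (((y - a) i + t : ℝ) : ℂ)) 1 0 :=
    ((hasDerivAt_id (0 : ℝ)).const_add ((y - a) i)).ofReal_comp
  unfold HasLineDerivAt
  refine h.congr_of_eventuallyEq (.of_forall fun t ↦ ?_)
  simp
  ring

end SoftDist

/-- Integration by parts against a Schwartz function. -/
lemma integral_mul_lineDerivOp {F F' : R3 → ℂ} (v : R3) (hF : Continuous F) (hF' : Continuous F')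
    (hb : ∃ C, ∀ y, ‖F y‖ ≤ C) (hb' : ∃ C, ∀ y, ‖F' y‖ ≤ C)
    (hd : ∀ y, HasLineDerivAt ℝ F (F' y) y v) (φ : 𝓢(R3, ℂ)) :
    ∫ y, F y * (∂_{v} φ) y = -∫ y, F' y * φ y := by
  obtain ⟨C, hC⟩ := hb
  obtain ⟨C', hC'⟩ := hb'
  refine integral_bilinear_hasLineDerivAt_right_eq_neg_left_of_integrable
    (B := ContinuousLinearMap.mul ℝ ℂ) (f := F) (f' := F') (g := φ) (g' := (∂_{v} φ : 𝓢(R3, ℂ))) (v := v)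
    ?_ ?_ ?_ (fun y _ ↦ hd y) (fun y _ ↦ ?_)
  · exact φ.integrable.bdd_mul hF'.aestronglyMeasurable (.of_forall hC')
  · exact (∂_{v} φ).integrable.bdd_mul hF.aestronglyMeasurable (.of_forall hC)
  · exact φ.integrable.bdd_mul hF.aestronglyMeasurable (.of_forall hC)
  · rw [SchwartzMap.lineDerivOp_apply_eq_fderiv]
    exact (φ.differentiableAt).hasFDerivAt.hasLineDerivAt v

section Profiles

/-- The profile `s ↦ exp (-k s) / s`; up to `4π` it is the Green function of `-Δ + k²`. -/
noncomputable def profile (k : ℂ) (s : ℝ) : ℂ := Complex.exp (-k * s) / s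

/-- The radial derivative of `profile k`, divided by `s`. -/
noncomputable def profile₁ (k : ℂ) (s : ℝ) : ℂ :=
  -(k / s ^ 2 + 1 / s ^ 3) * Complex.exp (-k * s)

/-- The radial derivative of `profile₁ k`. -/
noncomputable def profile₂ (k : ℂ) (s : ℝ) : ℂ :=
  (k ^ 2 / s ^ 2 + 3 * k / s ^ 3 + 3 / s ^ 4) * Complex.exp (-k * s)

variable (k : ℂ)

lemma hasDerivAt_exp_neg_mul (s : ℝ) :
    HasDerivAt (fun s : ℝ ↦ Complex.exp (-k * s)) (-k * Complex.exp (-k * s)) s := by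
  have h : HasDerivAt (fun s : ℝ ↦ -k * (s : ℂ)) (-k) s := by
    simpa using (Complex.ofRealCLM.hasDerivAt (x := s)).const_mul (-k)
  simpa [mul_comm] using h.cexp

lemma hasDerivAt_profile {s : ℝ} (hs : 0 < s) :
    HasDerivAt (profile k) (s * profile₁ k s) s := by
  have hs' : (s : ℂ) ≠ 0 := by exact_mod_cast hs.ne'
  have h := (hasDerivAt_exp_neg_mul k s).div (Complex.ofRealCLM.hasDerivAt (x := s)) hs'
  refine h.congr_deriv ?_
  simp only [Complex.ofRealCLM_apply, Complex.ofReal_one, profile₁]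
  field_simp
  ring

lemma hasDerivAt_profile₁ {s : ℝ} (hs : 0 < s) :
    HasDerivAt (profile₁ k) (profile₂ k s) s := by
  have hs' : (s : ℂ) ≠ 0 := by exact_mod_cast hs.ne'
  have hid : HasDerivAt (fun s : ℝ ↦ (s : ℂ)) 1 s := Complex.ofRealCLM.hasDerivAt (x := s)
  have h := (((hasDerivAt_const s k).div (hid.pow 2) (pow_ne_zero 2 hs')).add
    ((hasDerivAt_const s (1 : ℂ)).div (hid.pow 3) (pow_ne_zero 3 hs'))).neg.mul
    (hasDerivAt_exp_neg_mul k s)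
  refine h.congr_deriv ?_
  simp only [profile₂, Pi.pow_apply, Pi.neg_apply, Pi.add_apply, Pi.div_apply]
  field_simp
  ring

lemma continuousOn_profile : ContinuousOn (profile k) (Set.Ioi 0) :=
  fun _ hs ↦ (hasDerivAt_profile k hs).continuousAt.continuousWithinAt

lemma continuousOn_profile₁ : ContinuousOn (profile₁ k) (Set.Ioi 0) :=
  fun _ hs ↦ (hasDerivAt_profile₁ k hs).continuousAt.continuousWithinAt

lemma continuousOn_profile₂ : ContinuousOn (profile₂ k) (Set.Ioi 0) := by
  intro s hs
  have hs' : (s : ℂ) ≠ 0 := by exact_mod_cast (ne_of_gt hs)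
  unfold profile₂
  refine ContinuousAt.continuousWithinAt ?_
  have hid : ContinuousAt (fun s : ℝ ↦ (s : ℂ)) s := Complex.continuous_ofReal.continuousAt
  fun_prop (disch := positivity)

variable {k}

lemma norm_exp_neg_mul (k : ℂ) (s : ℝ) : ‖Complex.exp (-k * s)‖ = Real.exp (-k.re * s) := by
  rw [Complex.norm_exp]; simp

lemma norm_exp_neg_mul_le_one (hk : 0 < k.re) {s : ℝ} (hs : 0 < s) :
    ‖Complex.exp (-k * s)‖ ≤ 1 := by
  rw [norm_exp_neg_mul, Real.exp_le_one_iff]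
  nlinarith

lemma norm_profile (k : ℂ) {s : ℝ} (hs : 0 ≤ s) : ‖profile k s‖ = Real.exp (-k.re * s) / s := by
  rw [profile, norm_div, norm_exp_neg_mul, Complex.norm_real, Real.norm_of_nonneg hs]

lemma norm_profile_le (hk : 0 < k.re) {ε s : ℝ} (hε : 0 < ε) (hs : ε ≤ s) :
    ‖profile k s‖ ≤ 1 / ε := by
  have hs0 : 0 < s := hε.trans_le hs
  rw [profile, norm_div, Complex.norm_real, Real.norm_of_nonneg hs0.le]
  exact div_le_div₀ zero_le_one (norm_exp_neg_mul_le_one hk hs0) hε hs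

lemma mul_norm_profile₁_le (hk : 0 < k.re) {ε s : ℝ} (hε : 0 < ε) (hs : ε ≤ s) :
    s * ‖profile₁ k s‖ ≤ ‖k‖ / ε + 1 / ε ^ 2 := by
  have hs0 : 0 < s := hε.trans_le hs
  have h1 : ‖profile₁ k s‖ ≤ (‖k‖ / s ^ 2 + 1 / s ^ 3) * 1 := by
    rw [profile₁, norm_mul, norm_neg]
    gcongr
    · refine (norm_add_le _ _).trans (le_of_eq ?_)
      simp [abs_of_pos hs0]
    · exact norm_exp_neg_mul_le_one hk hs0
  calc s * ‖profile₁ k s‖ ≤ s * ((‖k‖ / s ^ 2 + 1 / s ^ 3) * 1) := by gcongr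
    _ = ‖k‖ / s + 1 / s ^ 2 := by field_simp
    _ ≤ _ := by gcongr

lemma mul_norm_profile₂_le (hk : 0 < k.re) {ε s : ℝ} (hε : 0 < ε) (hs : ε ≤ s) :
    s * ‖profile₂ k s‖ ≤ ‖k‖ ^ 2 / ε + 3 * ‖k‖ / ε ^ 2 + 3 / ε ^ 3 := by
  have hs0 : 0 < s := hε.trans_le hs
  have h1 : ‖profile₂ k s‖ ≤ (‖k‖ ^ 2 / s ^ 2 + 3 * ‖k‖ / s ^ 3 + 3 / s ^ 4) * 1 := by
    rw [profile₂, norm_mul]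
    gcongr
    · refine (norm_add₃_le).trans (le_of_eq ?_)
      simp [abs_of_pos hs0]
    · exact norm_exp_neg_mul_le_one hk hs0
  calc s * ‖profile₂ k s‖ ≤ s * ((‖k‖ ^ 2 / s ^ 2 + 3 * ‖k‖ / s ^ 3 + 3 / s ^ 4) * 1) := by gcongr
    _ = ‖k‖ ^ 2 / s + 3 * ‖k‖ / s ^ 2 + 3 / s ^ 3 := by field_simp
    _ ≤ _ := by gcongr

end Profiles

end PointInteraction

namespace PointInteraction

section Green

variable {k : ℂ} (hk : 0 < k.re) (a : R3) (φ : 𝓢(R3, ℂ))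

lemma abs_coord_le_softDist (ε : ℝ) (y : R3) (i : Fin 3) : |(y - a) i| ≤ softDist ε a y :=
  (PiLp.norm_apply_le (y - a) i).trans (norm_sub_le_softDist ε a y)

include hk in
/-- The smoothed Green function satisfies `(-Δ + k²) F_ε = ε² profile₂ k s / s` with
`s = √(|y - a|² + ε²)`, in the weak sense. -/
lemma integral_profile_softDist_mul {ε : ℝ} (hε : 0 < ε) :
    ∫ y, profile k (softDist ε a y) * (k ^ 2 * φ y - (Δ φ) y) =
      ∫ y, ε ^ 2 * profile₂ k (softDist ε a y) / softDist ε a y * φ y := by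
  set s := softDist ε a with hs_def
  have hs : ∀ y, 0 < s y := softDist_pos hε a
  have hse : ∀ y, ε ≤ s y := le_softDist a
  have hsc : Continuous s := continuous_softDist ε a
  have hne : ∀ y, (s y : ℂ) ≠ 0 := fun y ↦ by exact_mod_cast (hs y).ne'
  have hc₀ : Continuous fun y ↦ profile k (s y) :=
    (continuousOn_profile k).comp_continuous hsc hs
  have hc₁ : Continuous fun y ↦ profile₁ k (s y) :=
    (continuousOn_profile₁ k).comp_continuous hsc hs
  have hc₂ : Continuous fun y ↦ profile₂ k (s y) :=
    (continuousOn_profile₂ k).comp_continuous hsc hs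
  have hx : ∀ i, Continuous fun y : R3 ↦ ((y - a) i : ℂ) := fun i ↦ by fun_prop
  -- first and second derivatives of the smoothed Green function in the direction `i`
  set F₁ : Fin 3 → R3 → ℂ := fun i y ↦ profile₁ k (s y) * (y - a) i
  set F₂ : Fin 3 → R3 → ℂ := fun i y ↦
    (((y - a) i / s y : ℝ) * profile₂ k (s y)) * (y - a) i + profile₁ k (s y) * 1
  have hF₁ : ∀ i, Continuous (F₁ i) := fun i ↦ hc₁.mul (hx i)
  have hF₂ : ∀ i, Continuous (F₂ i) := fun i ↦ by
    have h1 : Continuous fun y : R3 ↦ (((y - a) i / s y : ℝ) : ℂ) :=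
      Complex.continuous_ofReal.comp (Continuous.div (by fun_prop) hsc fun y ↦ (hs y).ne')
    exact ((h1.mul hc₂).mul (hx i)).add (hc₁.mul continuous_const)
  have hd₁ : ∀ i y, HasLineDerivAt ℝ (fun y ↦ profile k (s y)) (F₁ i y) y
      (EuclideanSpace.single i (1 : ℝ)) := fun i y ↦ by
    have h := hasLineDerivAt_comp_softDist hε a y (fun t ht ↦ hasDerivAt_profile k ht) i
    have e : F₁ i y = ((y - a) i / softDist ε a y : ℝ) *
        ((softDist ε a y : ℂ) * profile₁ k (softDist ε a y)) := by
      simp only [F₁, ← hs_def]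
      push_cast
      have := hne y
      field_simp
    rw [e]
    exact h
  have hd₂ : ∀ i y, HasLineDerivAt ℝ (F₁ i) (F₂ i y) y
      (EuclideanSpace.single i (1 : ℝ)) := fun i y ↦ by
    have h1 := hasLineDerivAt_comp_softDist hε a y (fun t ht ↦ hasDerivAt_profile₁ k ht) i
    have h2 := hasLineDerivAt_coord a y i
    have h3 := HasDerivAt.mul h1 h2
    simp only [zero_smul, add_zero] at h3
    exact h3
  have hb₀ : ∃ C, ∀ y, ‖profile k (s y)‖ ≤ C := ⟨_, fun y ↦ norm_profile_le hk hε (hse y)⟩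
  have hb₁ : ∀ i, ∃ C, ∀ y, ‖F₁ i y‖ ≤ C := fun i ↦ ⟨_, fun y ↦ by
    refine le_trans ?_ (mul_norm_profile₁_le hk hε (hse y))
    rw [norm_mul, mul_comm, Complex.norm_real]
    gcongr
    exact abs_coord_le_softDist a ε y i⟩
  have hb₂ : ∀ i, ∃ C, ∀ y, ‖F₂ i y‖ ≤ C := fun i ↦
    ⟨(‖k‖ ^ 2 / ε + 3 * ‖k‖ / ε ^ 2 + 3 / ε ^ 3) + (‖k‖ / ε + 1 / ε ^ 2) / ε, fun y ↦ by
      refine (norm_add_le _ _).trans (add_le_add ?_ ?_)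
      · refine le_trans ?_ (mul_norm_profile₂_le hk hε (hse y))
        have hle := abs_coord_le_softDist a ε y i
        rw [norm_mul, norm_mul, Complex.norm_real, Complex.norm_real, norm_div,
          Real.norm_of_nonneg (hs y).le, Real.norm_eq_abs, mul_comm (|_| / _ * _)]
        have hsy := hs y
        have h1 : |(y - a) i| / s y ≤ 1 := (div_le_one (hs y)).mpr hle
        calc |(y - a) i| * (|(y - a) i| / s y * ‖profile₂ k (s y)‖)
            ≤ s y * (1 * ‖profile₂ k (s y)‖) := by gcongr
          _ = _ := by ring
      · rw [mul_one, le_div_iff₀ hε, mul_comm]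
        exact le_trans (by gcongr; exact hse y) (mul_norm_profile₁_le hk hε (hse y))⟩
  have hint : ∀ {F : R3 → ℂ}, Continuous F → (∃ C, ∀ y, ‖F y‖ ≤ C) → ∀ χ : 𝓢(R3, ℂ),
      Integrable fun y ↦ F y * χ y := fun hF ⟨C, hC⟩ χ ↦
    χ.integrable.bdd_mul hF.aestronglyMeasurable (.of_forall hC)
  have hΔ : ∀ y, (Δ φ) y = ∑ i : Fin 3, (∂_{(EuclideanSpace.single i (1 : ℝ) : R3)}
      (∂_{(EuclideanSpace.single i (1 : ℝ) : R3)} φ) : 𝓢(R3, ℂ)) y := fun y ↦ by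
    rw [SchwartzMap.laplacian_eq_sum (EuclideanSpace.basisFun (Fin 3) ℝ)]
    simp [EuclideanSpace.basisFun_apply]
  have hparts : ∫ y, profile k (s y) * (Δ φ) y = ∫ y, (∑ i, F₂ i y) * φ y := by
    simp only [hΔ, Finset.mul_sum, Finset.sum_mul]
    rw [integral_finsetSum _ fun i _ ↦ hint hc₀ hb₀ _,
      integral_finsetSum _ fun i _ ↦ hint (hF₂ i) (hb₂ i) _]
    refine Finset.sum_congr rfl fun i _ ↦ ?_
    rw [integral_mul_lineDerivOp _ hc₀ (hF₁ i) hb₀ (hb₁ i) (hd₁ i),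
      integral_mul_lineDerivOp _ (hF₁ i) (hF₂ i) (hb₁ i) (hb₂ i) (hd₂ i), neg_neg]
  have hsum : ∀ y, ∑ i, F₂ i y =
      k ^ 2 * profile k (s y) - ε ^ 2 * profile₂ k (s y) / s y := fun y ↦ by
    have hsq : ((y - a) 0 : ℂ) ^ 2 + ((y - a) 1 : ℂ) ^ 2 + ((y - a) 2 : ℂ) ^ 2 =
        (s y : ℂ) ^ 2 - ε ^ 2 := by
      have h1 := softDist_sq ε a y
      rw [EuclideanSpace.real_norm_sq_eq, Fin.sum_univ_three] at h1
      rw [eq_sub_iff_add_eq]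
      exact_mod_cast h1.symm
    have e : ∑ i, F₂ i y = (((y - a) 0 : ℂ) ^ 2 + ((y - a) 1 : ℂ) ^ 2 + ((y - a) 2 : ℂ) ^ 2) *
        profile₂ k (s y) / s y + 3 * profile₁ k (s y) := by
      simp only [F₂, Fin.sum_univ_three]
      push_cast
      ring
    rw [e, hsq]
    have h0 := hne y
    simp only [profile, profile₁, profile₂]
    field_simp
    ring
  have hi1 : Integrable fun y ↦ profile k (s y) * (k ^ 2 * φ y) := by
    simp only [mul_left_comm _ (k ^ 2)]
    exact (hint hc₀ hb₀ φ).const_mul _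
  have hi2 : Integrable fun y ↦ (∑ i, F₂ i y) * φ y := by
    simp only [Finset.sum_mul]
    exact integrable_finsetSum _ fun i _ ↦ hint (hF₂ i) (hb₂ i) φ
  simp only [mul_sub]
  rw [integral_sub hi1 (hint hc₀ hb₀ _), hparts, ← integral_sub hi1 hi2]
  refine integral_congr_ae (.of_forall fun y ↦ ?_)
  simp only [hsum]
  ring

/-- Rescaling by `ε` exhibits the error term as an approximate identity. -/
lemma integral_profile₂_eq_integral_rescaled {ε : ℝ} (hε : 0 < ε) :
    ∫ y, ε ^ 2 * profile₂ k (softDist ε a y) / softDist ε a y * φ y =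
      ∫ w, (((k * (ε * √(1 + ‖w‖ ^ 2) : ℝ)) ^ 2 + 3 * (k * (ε * √(1 + ‖w‖ ^ 2) : ℝ)) + 3) *
        Complex.exp (-k * (ε * √(1 + ‖w‖ ^ 2) : ℝ))) / (√(1 + ‖w‖ ^ 2) : ℂ) ^ 5 *
          φ (a + ε • w) := by
  have h1 := integral_add_left_eq_self (μ := (volume : Measure R3)) (fun y : R3 ↦
    (ε : ℂ) ^ 2 * profile₂ k (softDist ε a y) / softDist ε a y * φ y) a
  have h2 := Measure.integral_comp_smul (volume : Measure R3) (fun y : R3 ↦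
    (ε : ℂ) ^ 2 * profile₂ k (softDist ε a (a + y)) / softDist ε a (a + y) * φ (a + y)) ε
  rw [h1] at h2
  have h3 : |(ε ^ Module.finrank ℝ R3)⁻¹| = (ε ^ 3)⁻¹ := by
    rw [finrank_euclideanSpace, Fintype.card_fin, abs_of_pos (by positivity)]
  rw [h3, eq_comm, inv_smul_eq_iff₀ (by positivity), ← integral_smul] at h2
  rw [h2]
  refine integral_congr_ae (.of_forall fun w ↦ ?_)
  have hs : softDist ε a (a + ε • w) = ε * √(1 + ‖w‖ ^ 2) := by
    have e : ‖a + ε • w - a‖ ^ 2 + ε ^ 2 = ε ^ 2 * (1 + ‖w‖ ^ 2) := by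
      rw [add_sub_cancel_left, norm_smul, Real.norm_of_nonneg hε.le]
      ring
    rw [softDist, e, Real.sqrt_mul (sq_nonneg ε), Real.sqrt_sq hε.le]
  have hσ : (√(1 + ‖w‖ ^ 2) : ℂ) ≠ 0 := by
    exact_mod_cast (Real.sqrt_pos.mpr (by positivity : 0 < 1 + ‖w‖ ^ 2)).ne'
  have hε' : (ε : ℂ) ≠ 0 := by exact_mod_cast hε.ne'
  simp only [hs, profile₂, Complex.real_smul]
  push_cast
  field_simp

include hk in
lemma norm_quadratic_mul_exp_le {t : ℝ} (ht : 0 ≤ t) :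
    ‖((k * t) ^ 2 + 3 * (k * t) + 3) * Complex.exp (-k * t)‖ ≤
      2 * ‖k‖ ^ 2 / k.re ^ 2 + 3 * ‖k‖ / k.re + 3 := by
  have hq := Real.quadratic_le_exp_of_nonneg (mul_nonneg hk.le ht)
  rw [norm_mul, norm_exp_neg_mul, neg_mul, Real.exp_neg, ← div_eq_mul_inv,
    div_le_iff₀ (Real.exp_pos _)]
  have h1 : ‖(k * t) ^ 2 + 3 * (k * t) + 3‖ ≤ (‖k‖ * t) ^ 2 + 3 * (‖k‖ * t) + 3 := by
    refine norm_add₃_le.trans (le_of_eq ?_)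
    simp [abs_of_nonneg ht]
  refine h1.trans (le_trans ?_ (mul_le_mul_of_nonneg_left hq (by positivity)))
  have e1 : (‖k‖ * t) ^ 2 = 2 * ‖k‖ ^ 2 / k.re ^ 2 * ((k.re * t) ^ 2 / 2) := by field_simp
  have e2 : 3 * (‖k‖ * t) = 3 * ‖k‖ / k.re * (k.re * t) := by field_simp
  rw [e1, e2]
  have p0 : 0 ≤ 2 * ‖k‖ ^ 2 / k.re ^ 2 := by positivity
  have p1 : 0 ≤ 3 * ‖k‖ / k.re := by positivity
  have q1 : 0 ≤ k.re * t := by positivity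
  have q2 : 0 ≤ (k.re * t) ^ 2 / 2 := by positivity
  generalize 2 * ‖k‖ ^ 2 / k.re ^ 2 = A at *
  generalize 3 * ‖k‖ / k.re = B at *
  generalize k.re * t = u at *
  generalize u ^ 2 / 2 = v at *
  nlinarith [mul_nonneg p0 q1, mul_nonneg p1 q1, mul_nonneg p0 q2, mul_nonneg p1 q2]

include hk in
lemma tendsto_integral_rescaled :
    Tendsto (fun ε : ℝ ↦ ∫ w, (((k * (ε * √(1 + ‖w‖ ^ 2) : ℝ)) ^ 2 +
        3 * (k * (ε * √(1 + ‖w‖ ^ 2) : ℝ)) + 3) *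
        Complex.exp (-k * (ε * √(1 + ‖w‖ ^ 2) : ℝ))) / (√(1 + ‖w‖ ^ 2) : ℂ) ^ 5 *
          φ (a + ε • w)) (𝓝[>] 0) (𝓝 (4 * Real.pi * φ a)) := by
  obtain ⟨hi, hv⟩ := integrable_and_integral_three_div_sqrt_pow_five
  have hlim : (4 * Real.pi * φ a : ℂ) =
      ∫ w : R3, (3 : ℂ) / (√(1 + ‖w‖ ^ 2) : ℂ) ^ 5 * φ a := by
    rw [integral_mul_const]
    congr 1
    have h : ∫ w : R3, (3 : ℂ) / (√(1 + ‖w‖ ^ 2) : ℂ) ^ 5 =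
        ((∫ w : R3, 3 / √(1 + ‖w‖ ^ 2) ^ 5 : ℝ) : ℂ) := by
      rw [← integral_complex_ofReal]
      push_cast
      rfl
    rw [h, hv]
    push_cast
    rfl
  have hσ0 : ∀ w : R3, 0 < √(1 + ‖w‖ ^ 2) := fun w ↦ Real.sqrt_pos.mpr (by positivity)
  have hσ : ∀ w : R3, (√(1 + ‖w‖ ^ 2) : ℂ) ^ 5 ≠ 0 := fun w ↦ by
    exact_mod_cast (pow_pos (hσ0 w) 5).ne'
  set M : ℝ := 2 * ‖k‖ ^ 2 / k.re ^ 2 + 3 * ‖k‖ / k.re + 3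
  have hM : 0 ≤ M := by positivity
  obtain ⟨C, hC⟩ : ∃ C, ∀ y, ‖φ y‖ ≤ C :=
    ⟨_, φ.toBoundedContinuousFunction.norm_coe_le_norm⟩
  rw [hlim]
  refine tendsto_integral_filter_of_dominated_convergence
    (fun w ↦ M * (3 / √(1 + ‖w‖ ^ 2) ^ 5) * C) (.of_forall fun ε ↦ ?_) ?_
    ((hi.const_mul M).mul_const C) (.of_forall fun w ↦ ?_)
  · refine Continuous.aestronglyMeasurable ?_
    have := φ.continuous
    refine Continuous.mul (Continuous.div ?_ (by fun_prop) hσ) (by fun_prop)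
    fun_prop
  · filter_upwards [self_mem_nhdsWithin] with ε hε
    refine .of_forall fun w ↦ ?_
    have hσw := hσ0 w
    have hq := norm_quadratic_mul_exp_le hk (t := ε * √(1 + ‖w‖ ^ 2))
      (mul_nonneg (le_of_lt hε) hσw.le)
    rw [norm_mul, norm_div, norm_pow, Complex.norm_real, Real.norm_of_nonneg hσw.le]
    refine mul_le_mul ?_ (hC _) (norm_nonneg _) (by positivity)
    calc _ ≤ M / √(1 + ‖w‖ ^ 2) ^ 5 := by gcongr
      _ ≤ M * (3 / √(1 + ‖w‖ ^ 2) ^ 5) := by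
        rw [div_eq_mul_inv]
        gcongr
        rw [inv_eq_one_div]
        gcongr
        norm_num
  · have hcont : Continuous fun ε : ℝ ↦ (((k * (ε * √(1 + ‖w‖ ^ 2) : ℝ)) ^ 2 +
        3 * (k * (ε * √(1 + ‖w‖ ^ 2) : ℝ)) + 3) *
        Complex.exp (-k * (ε * √(1 + ‖w‖ ^ 2) : ℝ))) / (√(1 + ‖w‖ ^ 2) : ℂ) ^ 5 *
          φ (a + ε • w) := by
      have := φ.continuous
      fun_prop
    have := (hcont.tendsto 0).mono_left (nhdsWithin_le_nhds (s := Set.Ioi 0))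
    simpa using this

include hk in
lemma tendsto_integral_profile_softDist (ψ : 𝓢(R3, ℂ)) :
    Tendsto (fun ε : ℝ ↦ ∫ y, profile k (softDist ε a y) * ψ y) (𝓝[>] 0)
      (𝓝 (∫ y, profile k ‖y - a‖ * ψ y)) := by
  obtain ⟨C, hC⟩ : ∃ C, ∀ y, ‖ψ y‖ ≤ C :=
    ⟨_, ψ.toBoundedContinuousFunction.norm_coe_le_norm⟩
  have hi := integrable_exp_neg_mul_norm_sub_div_pow hk (n := 1) (by norm_num) a
  have hne : ∀ᵐ y : R3, y ≠ a := by simp [ae_iff, measure_singleton]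
  refine tendsto_integral_filter_of_dominated_convergence
    (fun y ↦ Real.exp (-k.re * ‖y - a‖) / ‖y - a‖ ^ 1 * C) ?_ ?_ (hi.mul_const C) ?_
  · filter_upwards [self_mem_nhdsWithin] with ε hε
    exact (((continuousOn_profile k).comp_continuous (continuous_softDist ε a)
      (softDist_pos hε a)).mul ψ.continuous).aestronglyMeasurable
  · filter_upwards [self_mem_nhdsWithin] with ε hε
    filter_upwards [hne] with y hy
    have hr : 0 < ‖y - a‖ := norm_sub_pos_iff.mpr hy
    have hle := norm_sub_le_softDist ε a y
    rw [norm_mul, norm_profile _ (softDist_pos hε a y).le, pow_one]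
    refine mul_le_mul ?_ (hC _) (norm_nonneg _) (by positivity)
    exact div_le_div₀ (Real.exp_pos _).le (Real.exp_le_exp.mpr (by nlinarith)) hr hle
  · filter_upwards [hne] with y hy
    have hr : 0 < ‖y - a‖ := norm_sub_pos_iff.mpr hy
    refine Tendsto.mul_const _ ?_
    have hs : Tendsto (fun ε : ℝ ↦ softDist ε a y) (𝓝[>] 0) (𝓝 ‖y - a‖) := by
      have hc : Continuous fun ε : ℝ ↦ softDist ε a y := by unfold softDist; fun_prop
      have := (hc.tendsto 0).mono_left (nhdsWithin_le_nhds (s := Set.Ioi 0))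
      simpa [softDist] using this
    exact ((hasDerivAt_profile k hr).continuousAt.tendsto).comp hs

include hk in
/-- `exp (-k r) / (4π r)` with `r = |y - a|` is the Green function of `-Δ + k²` with pole `a`. -/
lemma integral_profile_mul_helmholtz :
    ∫ y, profile k ‖y - a‖ * (k ^ 2 * φ y - (Δ φ) y) = 4 * Real.pi * φ a := by
  have h1 := tendsto_integral_profile_softDist hk a (k ^ 2 • φ - Δ φ)
  have h2 := tendsto_integral_rescaled hk a φ
  refine tendsto_nhds_unique h1 (h2.congr' ?_)
  filter_upwards [self_mem_nhdsWithin] with ε hε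
  rw [← integral_profile₂_eq_integral_rescaled a φ hε, ← integral_profile_softDist_mul hk a φ hε]
  simp

end Green

end PointInteraction

namespace PointInteraction

open FourierTransform TemperedDistribution

/-! ### The Green function as a square integrable function -/

/-- The Green function `exp (-k r) / (4π r)` of `-Δ + k²` with pole `a`. -/
noncomputable def greenFn (k : ℂ) (a y : R3) : ℂ := profile k ‖y - a‖ / (4 * Real.pi)

lemma measurable_profile_norm_sub (k : ℂ) (a : R3) :
    Measurable fun y : R3 ↦ profile k ‖y - a‖ := by
  unfold profile; fun_prop

lemma memLp_greenFn {k : ℂ} (hk : 0 < k.re) (a : R3) : MemLp (greenFn k a) 2 volume := by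
  have hm : Measurable (greenFn k a) := (measurable_profile_norm_sub k a).div_const _
  rw [memLp_two_iff_integrable_sq_norm hm.aestronglyMeasurable]
  have h := (integrable_exp_neg_mul_norm_sub_div_pow (κ := 2 * k.re) (by positivity) le_rfl a).div_const
    ((4 * Real.pi) ^ 2)
  refine h.congr (.of_forall fun y ↦ ?_)
  simp only [greenFn, norm_div, norm_profile k (norm_nonneg (y - a)), div_pow, ← Real.exp_nat_mul]
  have e1 : -(2 * k.re) * ‖y - a‖ = ((2 : ℕ) : ℝ) * (-k.re * ‖y - a‖) := by push_cast; ring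
  have e2 : ‖(4 * Real.pi : ℂ)‖ = 4 * Real.pi := by simp [abs_of_pos Real.pi_pos]
  rw [e1, e2]

/-- The Green function as an element of `L²(ℝ³)`. -/
noncomputable def greenL2 {k : ℂ} (hk : 0 < k.re) (a : R3) : L2 := (memLp_greenFn hk a).toLp _

lemma coeFn_greenL2 {k : ℂ} (hk : 0 < k.re) (a : R3) :
    greenL2 hk a =ᵐ[volume] greenFn k a := (memLp_greenFn hk a).coeFn_toLp

lemma integrable_schwartz_mul_L2 (χ : 𝓢(R3, ℂ)) (f : L2) : Integrable fun y ↦ χ y * f y :=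
  (χ.memLp 2).integrable_mul (Lp.memLp f)

/-- The Fourier transform of the Green function. -/
lemma fourier_greenL2 {k : ℂ} (hk : 0 < k.re) (a : R3) :
    (fun ξ ↦ (symbol ξ - -k ^ 2) * (𝓕 (greenL2 hk a) : L2) ξ) =ᵐ[volume]
      fun ξ ↦ Complex.exp (-(↑(2 * Real.pi * inner ℝ ξ a) * Complex.I)) := by
  set g := greenL2 hk a
  have hdelta : ∀ φ : 𝓢(R3, ℂ), k ^ 2 * toDistr g φ + (-Δ (toDistr g)) φ = φ a := by
    intro φ
    have h1 : (-Δ (toDistr g)) φ = -toDistr g (Δ φ) := by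
      rw [← TemperedDistribution.laplacian_apply_apply]
      rfl
    rw [h1, toDistr_apply, toDistr_apply, ← integral_const_mul, ← sub_eq_add_neg,
      ← integral_sub ((integrable_schwartz_mul_L2 φ g).const_mul _)
        (integrable_schwartz_mul_L2 (Δ φ) g)]
    have hpi : (4 * Real.pi : ℂ) ≠ 0 := by simp [Real.pi_ne_zero]
    have h2 : φ a = (∫ y, profile k ‖y - a‖ * (k ^ 2 * φ y - (Δ φ) y)) / (4 * Real.pi) := by
      rw [integral_profile_mul_helmholtz hk a φ, mul_div_cancel_left₀ _ hpi]
    rw [h2, ← integral_div]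
    refine integral_congr_ae ?_
    filter_upwards [coeFn_greenL2 hk a] with y hy
    simp only [g, hy, greenFn]
    ring
  refine ae_eq_of_integral_schwartz_mul
    (locallyIntegrable_continuous_mul (continuous_symbol.sub continuous_const)
      (locallyIntegrable_L2 _))
    (Continuous.locallyIntegrable (by fun_prop)) fun χ ↦ ?_
  have h1 := hdelta (𝓕 χ)
  have h2 : (-Δ (toDistr g)) (𝓕 χ) = ∫ ξ, χ ξ * (symbol ξ * (𝓕 g : L2) ξ) :=
    fourier_neg_laplacian_apply g χ
  have h3 : toDistr g (𝓕 χ) = ∫ ξ, χ ξ * (𝓕 g : L2) ξ := by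
    rw [← toDistr_apply]
    exact DFunLike.congr_fun (Lp.fourier_toTemperedDistribution_eq g) χ
  have h4 : Integrable fun ξ ↦ χ ξ * (symbol ξ * (𝓕 g : L2) ξ) := by
    have e := (integrable_schwartz_mul_L2 (SchwartzMap.smulLeftCLM ℂ
      (fun ξ : R3 ↦ Complex.ofReal (‖ξ‖ ^ 2)) χ) (𝓕 g)).const_mul ((2 * Real.pi) ^ 2 : ℂ)
    refine e.congr (.of_forall fun ξ ↦ ?_)
    simp only [SchwartzMap.smulLeftCLM_apply_apply hasTemperateGrowth_normSq, symbol, smul_eq_mul]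
    push_cast
    ring
  have h5 : (𝓕 χ) a = ∫ ξ, χ ξ * Complex.exp (-(↑(2 * Real.pi * inner ℝ ξ a) * Complex.I)) := by
    rw [SchwartzMap.fourier_coe, Real.fourier_eq']
    refine integral_congr_ae (.of_forall fun ξ ↦ ?_)
    simp only [smul_eq_mul]
    rw [mul_comm]
    congr 2
    push_cast
    ring
  rw [← h5, ← h1, h2, h3, ← integral_const_mul,
    ← integral_add ((integrable_schwartz_mul_L2 χ (𝓕 g)).const_mul _) h4]
  refine integral_congr_ae (.of_forall fun ξ ↦ ?_)
  ring

/-- The Green function represents point evaluation on `W^{2,2}(ℝ³)`. -/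
lemma inner_greenL2 {k : ℂ} (hk : 0 < k.re) (a : R3) (f : freeHamiltonian.domain) :
    inner ℂ (greenL2 hk a) (freeHamiltonian f - conj (-k ^ 2) • (f : L2)) = contRep f a :=
  inner_freeHamiltonian_sub _ a (fourier_greenL2 hk a) f

/-! ### The function `exp (-r)` -/

lemma memLp_exp_neg_norm_sub (a : R3) :
    MemLp (fun y : R3 ↦ ((Real.exp (-‖y - a‖) : ℝ) : ℂ)) 2 volume := by
  rw [memLp_two_iff_integrable_sq_norm (by fun_prop)]
  refine (integrable_exp_neg_mul_norm_sub_div_pow (κ := 2) two_pos (n := 0) (by norm_num)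
    a).congr (.of_forall fun y ↦ ?_)
  simp only [pow_zero, div_one, Complex.norm_real, Real.norm_eq_abs, Real.abs_exp,
    ← Real.exp_nat_mul]
  congr 1
  push_cast
  ring

/-- The function `exp (-|y - a|)` as an element of `L²(ℝ³)`. -/
noncomputable def expL2 (a : R3) : L2 := (memLp_exp_neg_norm_sub a).toLp _

lemma coeFn_expL2 (a : R3) :
    expL2 a =ᵐ[volume] fun y ↦ ((Real.exp (-‖y - a‖) : ℝ) : ℂ) :=
  (memLp_exp_neg_norm_sub a).coeFn_toLp

/-- Derivative in the parameter `k` of the integrand of the Green function identity. -/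
lemma hasDerivAt_profile_param (r : ℝ) (hr : r ≠ 0) (p q : ℂ) (k : ℝ) :
    HasDerivAt (fun k : ℝ ↦ profile k r * ((k : ℂ) ^ 2 * p - q))
      (2 * k * profile k r * p - Complex.exp (-(k : ℂ) * r) * ((k : ℂ) ^ 2 * p - q)) k := by
  have hr' : (r : ℂ) ≠ 0 := by exact_mod_cast hr
  have hid : HasDerivAt (fun k : ℝ ↦ (k : ℂ)) 1 k := Complex.ofRealCLM.hasDerivAt (x := k)
  have h1 := ((hid.neg.mul_const (r : ℂ)).cexp).div_const (r : ℂ)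
  have h2 := ((hid.pow 2).mul_const p).sub_const q
  refine (h1.mul h2).congr_deriv ?_
  simp only [profile, Pi.pow_apply, Pi.neg_apply, Nat.cast_ofNat, Nat.add_one_sub_one, pow_one]
  field_simp
  ring

/-- Differentiating the Green function identity in `k` at `k = 1` yields
`(-Δ + 1) exp (-r) = 2 exp (-r) / r` weakly. -/
lemma integral_exp_mul_helmholtz (a : R3) (φ : 𝓢(R3, ℂ)) :
    ∫ y, (2 * profile 1 ‖y - a‖ * φ y -
      Complex.exp (-1 * (‖y - a‖ : ℝ)) * (φ y - (Δ φ) y)) = 0 := by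
  obtain ⟨C, hC⟩ : ∃ C, ∀ y, ‖φ y‖ ≤ C :=
    ⟨_, φ.toBoundedContinuousFunction.norm_coe_le_norm⟩
  obtain ⟨D, hD⟩ : ∃ D, ∀ y, ‖(Δ φ) y‖ ≤ D :=
    ⟨_, (Δ φ).toBoundedContinuousFunction.norm_coe_le_norm⟩
  have hC0 : 0 ≤ C := (norm_nonneg _).trans (hC 0)
  have hne : ∀ᵐ y : R3, y ≠ a := by simp [ae_iff, measure_singleton]
  have hi0 := integrable_exp_neg_mul_norm_sub_div_pow (κ := 1 / 2) (by norm_num) (n := 0)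
    (by norm_num) a
  have hi1 := integrable_exp_neg_mul_norm_sub_div_pow (κ := 1 / 2) (by norm_num) (n := 1)
    (by norm_num) a
  have hm := fun k : ℂ ↦ measurable_profile_norm_sub k a
  have hφ := φ.continuous.measurable
  have hΔ := (Δ φ).continuous.measurable
  have hdom : ∀ k : ℝ, 1 / 2 ≤ k → ∀ y,
      Real.exp (-k * ‖y - a‖) ≤ Real.exp (-(1 / 2) * ‖y - a‖) := fun k hk y ↦
    Real.exp_le_exp.mpr (by nlinarith [norm_nonneg (y - a)])
  have key := hasDerivAt_integral_of_dominated_loc_of_deriv_le (μ := (volume : Measure R3))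
    (F := fun (k : ℝ) (y : R3) ↦ profile k ‖y - a‖ * ((k : ℂ) ^ 2 * φ y - (Δ φ) y))
    (F' := fun (k : ℝ) (y : R3) ↦ 2 * k * profile k ‖y - a‖ * φ y -
      Complex.exp (-(k : ℂ) * (‖y - a‖ : ℝ)) * ((k : ℂ) ^ 2 * φ y - (Δ φ) y))
    (x₀ := 1) (s := Metric.ball 1 (1 / 2))
    (bound := fun y ↦ 3 * C * (Real.exp (-(1 / 2) * ‖y - a‖) / ‖y - a‖ ^ 1) +
      (4 * C + D) * (Real.exp (-(1 / 2) * ‖y - a‖) / ‖y - a‖ ^ 0))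
    (Metric.ball_mem_nhds _ (by norm_num)) (.of_forall fun k ↦ ?_) ?_ ?_ ?_ ?_ ?_
  · have hconst : ∀ᶠ k : ℝ in 𝓝 1,
        ∫ y, profile k ‖y - a‖ * ((k : ℂ) ^ 2 * φ y - (Δ φ) y) = 4 * Real.pi * φ a := by
      filter_upwards [lt_mem_nhds (one_pos : (0 : ℝ) < 1)] with k hk
      exact integral_profile_mul_helmholtz (k := (k : ℂ)) (by simpa using hk) a φ
    have h0 := (hasDerivAt_const (1 : ℝ) (4 * Real.pi * φ a)).congr_of_eventuallyEq hconst
    have := key.2.unique h0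
    simpa using this
  · exact ((hm k).mul (((hφ.const_mul _)).sub hΔ)).aestronglyMeasurable
  · have hp : Integrable fun y ↦ profile ((1 : ℝ) : ℂ) ‖y - a‖ := by
      refine ((integrable_exp_neg_mul_norm_sub_div_pow (κ := 1) one_pos (n := 1) (by norm_num)
        a).mono' (hm _).aestronglyMeasurable (.of_forall fun y ↦ ?_))
      rw [norm_profile _ (norm_nonneg _)]
      simp
    have hb : ∃ B, ∀ y, ‖((1 : ℝ) : ℂ) ^ 2 * φ y - (Δ φ) y‖ ≤ B := ⟨C + D, fun y ↦ by
      simpa using (norm_sub_le (φ y) ((Δ φ) y)).trans (add_le_add (hC y) (hD y))⟩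
    obtain ⟨B, hB⟩ := hb
    simp only [mul_comm (profile _ _)]
    exact hp.bdd_mul ((hφ.const_mul _).sub hΔ).aestronglyMeasurable (.of_forall hB)
  · refine Measurable.aestronglyMeasurable ?_
    refine (((hm _).const_mul _).mul hφ).sub (Measurable.mul ?_ ((hφ.const_mul _).sub hΔ))
    fun_prop
  · filter_upwards with y k hk
    rw [Metric.mem_ball, Real.dist_eq, abs_lt] at hk
    have hk1 : 1 / 2 ≤ k := by linarith
    have hk2 : k ≤ 3 / 2 := by linarith
    have hk0 : 0 ≤ k := by linarith
    have he := hdom k hk1 y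
    have hsq : k ^ 2 ≤ 4 := by nlinarith
    refine (norm_sub_le _ _).trans (add_le_add ?_ ?_)
    · rw [norm_mul, norm_mul, norm_mul, norm_profile _ (norm_nonneg _), Complex.ofReal_re, pow_one]
      simp only [Complex.norm_ofNat, Complex.norm_real, Real.norm_of_nonneg hk0]
      calc 2 * k * (Real.exp (-k * ‖y - a‖) / ‖y - a‖) * ‖φ y‖
          ≤ 2 * (3 / 2) * (Real.exp (-(1 / 2) * ‖y - a‖) / ‖y - a‖) * C := by
            gcongr
            exact hC y
        _ = _ := by ring
    · rw [norm_mul, norm_exp_neg_mul, Complex.ofReal_re, mul_comm, pow_zero, div_one]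
      refine mul_le_mul ?_ he (Real.exp_pos _).le (by linarith [(norm_nonneg _).trans (hD 0)])
      refine (norm_sub_le _ _).trans (add_le_add ?_ (hD y))
      rw [norm_mul, norm_pow, Complex.norm_real, Real.norm_of_nonneg hk0]
      exact mul_le_mul hsq (hC y) (norm_nonneg _) (by norm_num)
  · exact (hi1.const_mul _).add (hi0.const_mul _)
  · filter_upwards [hne] with y hy k _
    exact hasDerivAt_profile_param _ (norm_sub_pos_iff.mpr hy).ne' _ _ k

lemma one_re_pos : 0 < (1 : ℂ).re := by simp

/-- `exp (-r)` is in `W^{2,2}(ℝ³)`, and `-Δ exp (-r) = 2 exp (-r) / r - exp (-r)`. -/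
lemma freeHamiltonian_expL2 (a : R3) : ∃ h : expL2 a ∈ freeHamiltonian.domain,
    freeHamiltonian ⟨expL2 a, h⟩ = (8 * Real.pi : ℂ) • greenL2 one_re_pos a - expL2 a := by
  refine exists_freeHamiltonian ?_
  ext φ
  have h1 : (-Δ (toDistr (expL2 a))) φ = -toDistr (expL2 a) (Δ φ) := by
    rw [← TemperedDistribution.laplacian_apply_apply]
    rfl
  rw [h1, toDistr_apply, toDistr_apply, eq_neg_iff_add_eq_zero,
    ← integral_add (integrable_schwartz_mul_L2 φ _) (integrable_schwartz_mul_L2 (Δ φ) _),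
    ← integral_exp_mul_helmholtz a φ]
  refine integral_congr_ae ?_
  have hpi : (Real.pi : ℂ) ≠ 0 := by simp [Real.pi_ne_zero]
  filter_upwards [coeFn_expL2 a, coeFn_greenL2 one_re_pos a,
    Lp.coeFn_sub ((8 * Real.pi : ℂ) • greenL2 one_re_pos a) (expL2 a),
    Lp.coeFn_smul (8 * Real.pi : ℂ) (greenL2 one_re_pos a)] with y e1 e2 e3 e4
  rw [e3, Pi.sub_apply, e4, Pi.smul_apply, e1, e2, greenFn, smul_eq_mul]
  push_cast
  rw [neg_one_mul]
  field_simp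
  ring

/-! ### Behaviour at the singularities -/

lemma tendsto_norm_sub (a : R3) : Tendsto (fun y ↦ ‖y - a‖) (𝓝[≠] a) (𝓝[≠] 0) := by
  refine tendsto_nhdsWithin_iff.mpr ⟨?_, ?_⟩
  · have : Continuous fun y : R3 ↦ ‖y - a‖ := by fun_prop
    simpa using (this.tendsto a).mono_left nhdsWithin_le_nhds
  · filter_upwards [self_mem_nhdsWithin] with y hy
    exact (norm_sub_pos_iff.mpr hy).ne'

lemma tendsto_ofReal_norm_sub (a : R3) :
    Tendsto (fun y ↦ (‖y - a‖ : ℂ)) (𝓝[≠] a) (𝓝 0) :=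
  (Complex.continuous_ofReal.tendsto' 0 0 rfl).comp
    ((tendsto_norm_sub a).mono_right nhdsWithin_le_nhds)

lemma continuousAt_greenFn (k : ℂ) {a b : R3} (h : b ≠ a) : ContinuousAt (greenFn k a) b := by
  have hr : 0 < ‖b - a‖ := norm_sub_pos_iff.mpr h
  have h1 : ContinuousAt (fun y : R3 ↦ ‖y - a‖) b := by fun_prop
  exact ((hasDerivAt_profile k hr).continuousAt.comp_of_eq h1 rfl).div_const _

lemma tendsto_greenFn_mul_norm (k : ℂ) (a : R3) :
    Tendsto (fun y ↦ greenFn k a y * (‖y - a‖ : ℂ)) (𝓝[≠] a) (𝓝 (1 / (4 * Real.pi))) := by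
  have h : Tendsto (fun r : ℝ ↦ Complex.exp (-k * r) / (4 * Real.pi)) (𝓝[≠] 0)
      (𝓝 (1 / (4 * Real.pi))) := by
    have hc : Continuous fun r : ℝ ↦ Complex.exp (-k * r) / (4 * Real.pi) := by fun_prop
    have := (hc.tendsto 0).mono_left (nhdsWithin_le_nhds (s := {0}ᶜ))
    simpa using this
  refine (h.comp (tendsto_norm_sub a)).congr' ?_
  filter_upwards [self_mem_nhdsWithin] with y hy
  have hr : (‖y - a‖ : ℂ) ≠ 0 := by exact_mod_cast (norm_sub_pos_iff.mpr hy).ne'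
  simp only [Function.comp_apply, greenFn, profile]
  field_simp

lemma tendsto_greenFn_sub (k : ℂ) (a : R3) :
    Tendsto (fun y ↦ greenFn k a y - 1 / (4 * Real.pi * (‖y - a‖ : ℂ))) (𝓝[≠] a)
      (𝓝 (-k / (4 * Real.pi))) := by
  have hd := (hasDerivAt_exp_neg_mul k 0).tendsto_slope_zero
  simp only [Complex.ofReal_zero, mul_zero, Complex.exp_zero, mul_one, zero_add] at hd
  refine ((hd.comp (tendsto_norm_sub a)).div_const (4 * Real.pi)).congr' ?_
  filter_upwards [self_mem_nhdsWithin] with y hy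
  have hr : (‖y - a‖ : ℂ) ≠ 0 := by exact_mod_cast (norm_sub_pos_iff.mpr hy).ne'
  have hpi : (Real.pi : ℂ) ≠ 0 := by simp [Real.pi_ne_zero]
  simp only [Function.comp_apply, greenFn, profile, Complex.real_smul]
  push_cast
  field_simp

section Points

variable {m : ℕ} {x : Fin m → R3} (hx : Function.Injective x)

/-- The matrix of the map from `c` to the regular part of `∑ j, c j * greenFn 1 (x j)` at the poles: the
off-diagonal values and the regularised diagonal values of the Green functions with
`k = 1`. -/
noncomputable def greenMatrix (x : Fin m → R3) (i j : Fin m) : ℂ :=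
  if i = j then -1 / (4 * Real.pi) else greenFn 1 (x j) (x i)

lemma conj_greenMatrix (i j : Fin m) : conj (greenMatrix x i j) = greenMatrix x j i := by
  have h : ∀ r : ℝ, conj (profile 1 r) = profile 1 r := fun r ↦ by
    have : profile 1 r = ((Real.exp (-r) / r : ℝ) : ℂ) := by simp [profile]
    rw [this, Complex.conj_ofReal]
  by_cases hij : i = j
  · simp [greenMatrix, hij, map_ofNat]
  · simp only [greenMatrix, hij, Ne.symm hij, if_false, greenFn, map_div₀, h, map_mul,
      Complex.conj_ofReal, Complex.conj_ofNat, norm_sub_rev (x i)]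

lemma continuousOn_sum_greenFn (k : ℂ) (c : Fin m → ℂ) :
    ContinuousOn (fun y ↦ ∑ j, c j * greenFn k (x j) y) (Set.range x)ᶜ := by
  refine continuousOn_finsetSum _ fun j _ y hy ↦ ?_
  refine ((continuousAt_greenFn k fun h ↦ hy ⟨j, h.symm⟩).const_mul (c j)).continuousWithinAt

lemma isOpen_compl_range : IsOpen (Set.range x)ᶜ := (Set.finite_range x).isClosed.isOpen_compl

lemma compl_range_mem_nhdsNE (x : Fin m → R3) (i : Fin m) : (Set.range x)ᶜ ∈ 𝓝[≠] (x i) := by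
  have h : (Set.range x \ {x i})ᶜ ∈ 𝓝 (x i) :=
    ((Set.finite_range x).subset Set.sdiff_subset).isClosed.isOpen_compl.mem_nhds (by simp)
  filter_upwards [nhdsWithin_le_nhds h, self_mem_nhdsWithin] with y h1 h2 h3
  exact h1 ⟨h3, h2⟩

include hx in
/-- The singular part of a combination of Green functions at a pole. -/
lemma tendsto_sum_greenFn_mul_norm (k : ℂ) (c : Fin m → ℂ) (i : Fin m) :
    Tendsto (fun y ↦ (∑ j, c j * greenFn k (x j) y) * (‖y - x i‖ : ℂ)) (𝓝[≠] (x i))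
      (𝓝 (c i / (4 * Real.pi))) := by
  have hn := tendsto_ofReal_norm_sub (x i)
  simp only [Finset.sum_mul]
  have hl : c i / (4 * Real.pi) = ∑ j, if j = i then c i / (4 * Real.pi) else 0 := by simp
  rw [hl]
  refine tendsto_finsetSum _ fun j _ ↦ ?_
  by_cases hji : j = i
  · subst hji
    have := (tendsto_greenFn_mul_norm k (x j)).const_mul (c j)
    simpa [mul_assoc, div_eq_mul_inv] using this
  · have h1 := (continuousAt_greenFn k (a := x j) (b := x i) fun h ↦ hji (hx h).symm).tendsto
    have h2 := ((h1.mono_left nhdsWithin_le_nhds).const_mul (c j)).mul hn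
    simpa [hji] using h2

include hx in
/-- The regular part of a combination of Green functions at a pole. -/
lemma tendsto_sum_greenFn_sub (c : Fin m → ℂ) (i : Fin m) :
    Tendsto (fun y ↦ ∑ j, c j * greenFn 1 (x j) y - c i / (4 * Real.pi * (‖y - x i‖ : ℂ)))
      (𝓝[≠] (x i)) (𝓝 (∑ j, greenMatrix x i j * c j)) := by
  have e : ∀ y, ∑ j, c j * greenFn 1 (x j) y - c i / (4 * Real.pi * (‖y - x i‖ : ℂ)) =
      ∑ j, c j * (greenFn 1 (x j) y -
        if j = i then 1 / (4 * Real.pi * (‖y - x i‖ : ℂ)) else 0) := fun y ↦ by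
    simp [mul_sub, Finset.sum_sub_distrib, div_eq_mul_inv]
  simp only [e]
  refine tendsto_finsetSum _ fun j _ ↦ ?_
  rw [mul_comm (greenMatrix x i j)]
  refine Tendsto.const_mul (c j) ?_
  by_cases hji : j = i
  · subst hji
    simpa [greenMatrix] using tendsto_greenFn_sub 1 (x j)
  · have h1 := (continuousAt_greenFn 1 (a := x j) (b := x i) fun h ↦ hji (hx h).symm).tendsto
    simpa [hji, greenMatrix, Ne.symm hji] using h1.mono_left nhdsWithin_le_nhds

/-- Two representatives that are continuous off the points agree there. -/
lemma IsRegularRep.eqOn {f : L2} {g h : R3 → ℂ} (hg : IsRegularRep x f g)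
    (hh : IsRegularRep x f h) : Set.EqOn g h (Set.range x)ᶜ :=
  Measure.eqOn_open_of_ae_eq (ae_restrict_of_ae (hg.2.symm.trans hh.2)) isOpen_compl_range hg.1 hh.1

lemma coeFn_sum_greenL2 {k : ℂ} (hk : 0 < k.re) (c : Fin m → ℂ) :
    (∑ j, c j • greenL2 hk (x j) : L2) =ᵐ[volume] fun y ↦ ∑ j, c j * greenFn k (x j) y := by
  refine (Lp.coeFn_finsetSum _ _).trans ?_
  have h1 : ∀ᵐ y, ∀ j, (c j • greenL2 hk (x j) : L2) y = c j * greenFn k (x j) y := by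
    rw [ae_all_iff]
    intro j
    filter_upwards [Lp.coeFn_smul (c j) (greenL2 hk (x j)), coeFn_greenL2 hk (x j)] with y e1 e2
    rw [e1, Pi.smul_apply, e2, smul_eq_mul]
  filter_upwards [h1] with y hy
  simp only [Finset.sum_apply, hy]

/-- The regular representative of `u + ∑ j, c j • G j` with `u ∈ W^{2,2}(ℝ³)`. -/
lemma isRegularRep_add_sum {f u : L2} (hu : u ∈ W22) {k : ℂ} (hk : 0 < k.re) (c : Fin m → ℂ)
    (hf : f = u + ∑ j, c j • greenL2 hk (x j)) :
    IsRegularRep x f fun y ↦ contRep u y + ∑ j, c j * greenFn k (x j) y := by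
  refine ⟨(continuous_contRep hu).continuousOn.add (continuousOn_sum_greenFn k c), ?_⟩
  rw [hf]
  exact (Lp.coeFn_add _ _).trans ((ae_eq_contRep hu).add (coeFn_sum_greenL2 hk c))

include hx in
lemma tendsto_rep_mul_norm {f u : L2} (hu : u ∈ W22) {k : ℂ} (hk : 0 < k.re) (c : Fin m → ℂ)
    (hf : f = u + ∑ j, c j • greenL2 hk (x j)) {g : R3 → ℂ} (hg : IsRegularRep x f g)
    (i : Fin m) :
    Tendsto (fun y ↦ g y * (‖y - x i‖ : ℂ)) (𝓝[≠] (x i)) (𝓝 (c i / (4 * Real.pi))) := by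
  have hn := tendsto_ofReal_norm_sub (x i)
  have h1 := ((((continuous_contRep hu).tendsto (x i)).mono_left nhdsWithin_le_nhds).mul hn).add
    (tendsto_sum_greenFn_mul_norm hx k c i)
  rw [mul_zero, zero_add] at h1
  refine h1.congr' ?_
  filter_upwards [compl_range_mem_nhdsNE x i] with y hy
  rw [hg.eqOn (isRegularRep_add_sum hu hk c hf) hy]
  ring

include hx in
lemma tendsto_rep_sub {f u : L2} (hu : u ∈ W22) (c : Fin m → ℂ)
    (hf : f = u + ∑ j, c j • greenL2 one_re_pos (x j)) {g : R3 → ℂ} (hg : IsRegularRep x f g)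
    (i : Fin m) :
    Tendsto (fun y ↦ g y - c i / (4 * Real.pi * (‖y - x i‖ : ℂ))) (𝓝[≠] (x i))
      (𝓝 (contRep u (x i) + ∑ j, greenMatrix x i j * c j)) := by
  have h1 := (((continuous_contRep hu).tendsto (x i)).mono_left nhdsWithin_le_nhds).add
    (tendsto_sum_greenFn_sub hx c i)
  refine h1.congr' ?_
  filter_upwards [compl_range_mem_nhdsNE x i] with y hy
  rw [hg.eqOn (isRegularRep_add_sum hu one_re_pos c hf) hy]
  ring

include hx in
/-- The Green functions are linearly independent modulo `W^{2,2}(ℝ³)`, because functions in that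
space have no singularities. -/
lemma eq_zero_of_sum_greenL2_mem {k : ℂ} (hk : 0 < k.re) (c : Fin m → ℂ)
    (h : ∑ j, c j • greenL2 hk (x j) ∈ W22) : c = 0 := by
  set u := ∑ j, c j • greenL2 hk (x j)
  have hrep : IsRegularRep x u (contRep u) :=
    ⟨(continuous_contRep h).continuousOn, ae_eq_contRep h⟩
  ext i
  have h1 := tendsto_rep_mul_norm hx W22.zero_mem hk c (by rw [zero_add]) hrep i
  have h2 := tendsto_rep_mul_norm hx h hk (0 : Fin m → ℂ) (by simp) hrep i
  have h3 := tendsto_nhds_unique h1 h2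
  simpa [div_eq_zero_iff, Real.pi_ne_zero] using h3

end Points

end PointInteraction

namespace PointInteraction

/-! ### The defect subspaces of the minimal operator -/

section SquareRoot

lemma sqrtBranch_sq (z : ℂ) : sqrtBranch z ^ 2 = z := by
  have h : (z ^ (1 / 2 : ℂ)) ^ 2 = z := by
    rw [one_div]
    exact Complex.cpow_nat_inv_pow z two_ne_zero
  unfold sqrtBranch
  split_ifs
  · exact h
  · rw [neg_sq, h]

lemma sqrtBranch_im_pos {z : ℂ} (hz : z ∉ Complex.ofReal '' Set.Ici (0 : ℝ)) :
    0 < (sqrtBranch z).im := by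
  have hz0 : z ≠ 0 := by
    rintro rfl
    exact hz ⟨0, Set.mem_Ici.mpr le_rfl, by simp⟩
  have him : (z ^ (1 / 2 : ℂ)).im =
      Real.exp (Real.log ‖z‖ / 2) * Real.sin (z.arg / 2) := by
    rw [Complex.cpow_def_of_ne_zero hz0, Complex.exp_im]
    have e : Complex.log z * (1 / 2) = ((1 / 2 : ℝ) : ℂ) * Complex.log z := by
      push_cast; ring
    rw [e, Complex.re_ofReal_mul, Complex.im_ofReal_mul, Complex.log_re, Complex.log_im]
    congr 2 <;> ring
  unfold sqrtBranch
  split_ifs with h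
  · have h0 : 0 < z.arg := by
      refine lt_of_le_of_ne (Complex.arg_nonneg_iff.mpr h) fun h0 ↦ hz ?_
      obtain ⟨h1, h2⟩ := Complex.arg_eq_zero_iff.mp h0.symm
      exact ⟨z.re, h1, Complex.ext (by simp) (by simp [h2])⟩
    rw [him]
    exact mul_pos (Real.exp_pos _) (Real.sin_pos_of_pos_of_lt_pi (by linarith)
      (by linarith [Complex.arg_le_pi z, Real.pi_pos]))
  · have h0 : z.arg < 0 := Complex.arg_neg_iff.mpr (not_le.mp h)
    rw [Complex.neg_im, him, neg_pos]
    exact mul_neg_of_pos_of_neg (Real.exp_pos _) (Real.sin_neg_of_neg_of_neg_pi_lt (by linarith)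
      (by linarith [Complex.neg_pi_lt_arg z, Real.pi_pos]))

/-- The wave number `k = -i √z`, for which `k² = -z` and `Re k > 0`. -/
noncomputable def waveNumber (z : ℂ) : ℂ := -Complex.I * sqrtBranch z

lemma waveNumber_re_pos {z : ℂ} (hz : z ∉ Complex.ofReal '' Set.Ici (0 : ℝ)) :
    0 < (waveNumber z).re := by
  simpa [waveNumber] using sqrtBranch_im_pos hz

lemma neg_waveNumber_sq (z : ℂ) : -waveNumber z ^ 2 = z := by
  rw [waveNumber, mul_pow, neg_sq, Complex.I_sq, sqrtBranch_sq]
  ring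

lemma conj_notMem {z : ℂ} (hz : z ∉ Complex.ofReal '' Set.Ici (0 : ℝ)) :
    conj z ∉ Complex.ofReal '' Set.Ici (0 : ℝ) := by
  rintro ⟨r, hr, h⟩
  exact hz ⟨r, hr, by rw [← Complex.conj_conj z, ← h, Complex.conj_ofReal]⟩

lemma notMem_of_im_ne_zero {z : ℂ} (hz : z.im ≠ 0) :
    z ∉ Complex.ofReal '' Set.Ici (0 : ℝ) := by
  rintro ⟨r, -, rfl⟩
  exact hz (Complex.ofReal_im r)

lemma neg_one_notMem : (-1 : ℂ) ∉ Complex.ofReal '' Set.Ici (0 : ℝ) := by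
  rintro ⟨r, hr, h⟩
  have := congrArg Complex.re h
  simp only [Complex.ofReal_re, Complex.neg_re, Complex.one_re] at this
  have hr' : 0 ≤ r := hr
  linarith

end SquareRoot

variable {m : ℕ}

lemma defectFunction_eq (x : Fin m → R3) (z : ℂ) (c : Fin m → ℂ) :
    defectFunction x z c = fun y ↦ ∑ j, c j * greenFn (waveNumber z) (x j) y := by
  ext y
  refine Finset.sum_congr rfl fun j _ ↦ ?_
  rw [greenFn, profile, waveNumber, div_div, mul_comm (‖y - x j‖ : ℂ)]
  congr 3
  ring

lemma surjective_freeHamiltonian_add_one (ψ : L2) :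
    ∃ u : freeHamiltonian.domain, freeHamiltonian u + (u : L2) = ψ := by
  simpa using surjective_freeHamiltonian_sub neg_one_notMem ψ

lemma inner_greenL2_one (a : R3) (f : freeHamiltonian.domain) :
    inner ℂ (greenL2 one_re_pos a) (freeHamiltonian f + (f : L2)) = contRep f a := by
  simpa using inner_greenL2 one_re_pos a f

/-- Vanishing at `x j` is orthogonality of `(-Δ + 1) f` to the Green function with pole `x j`. -/
lemma isFiniteRestriction_minimalOperator {x : Fin m → R3} (hx : Function.Injective x) :
    Extension.IsFiniteRestriction freeHamiltonian (minimalOperator x)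
      fun j ↦ greenL2 one_re_pos (x j) where
  symm := freeHamiltonian_isFormalAdjoint
  surj := surjective_freeHamiltonian_add_one
  le := LinearPMap.domRestrict_le
  mem_iff f := by
    simp only [inner_greenL2_one]
    rw [← mem_vanishingAt_iff x f.2]
    exact ⟨fun h ↦ h.1, fun h ↦ ⟨h, f.2⟩⟩
  indep c h := eq_zero_of_sum_greenL2_mem hx one_re_pos c h

section Defect

variable {x : Fin m → R3} (hx : Function.Injective x) {z : ℂ}
  (hz : z ∉ Complex.ofReal '' Set.Ici (0 : ℝ))

include hx in
lemma mem_defectSubspace_iff (f : L2) :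
    f ∈ Extension.defectSubspace (minimalOperator x) z ↔
      ∃ c : Fin m → ℂ, f = ∑ j, c j • greenL2 (waveNumber_re_pos hz) (x j) :=
  (isFiniteRestriction_minimalOperator hx).mem_defectSubspace_iff _
    (surjective_freeHamiltonian_sub (conj_notMem hz)) (fun j f ↦ by
      have := inner_greenL2 (waveNumber_re_pos hz) (x j) f
      rw [neg_waveNumber_sq] at this
      rw [this, inner_greenL2_one]) f

include hx hz in
lemma rank_defectSubspace :
    Module.rank ℂ (Extension.defectSubspace (minimalOperator x) z) = m := by
  have h := Extension.IsFiniteRestriction.rank_defectSubspace (B := minimalOperator x) (z := z)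
    (fun j ↦ greenL2 (waveNumber_re_pos hz) (x j)) (mem_defectSubspace_iff hx hz)
    fun c hc ↦ eq_zero_of_sum_greenL2_mem hx (waveNumber_re_pos hz) c
      (by rw [hc]; exact W22.zero_mem)
  simpa using h

include hz in
lemma ae_eq_defectFunction_iff (f : L2) (c : Fin m → ℂ) :
    f =ᵐ[volume] defectFunction x z c ↔
      f = ∑ j, c j • greenL2 (waveNumber_re_pos hz) (x j) := by
  have h := coeFn_sum_greenL2 (x := x) (waveNumber_re_pos hz) c
  rw [← defectFunction_eq] at h
  exact ⟨fun hf ↦ Lp.ext (hf.trans h.symm), fun hf ↦ hf ▸ h⟩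

include hz in
lemma memLp_defectFunction (c : Fin m → ℂ) : MemLp (defectFunction x z c) 2 volume := by
  rw [defectFunction_eq]
  exact memLp_finsetSum _ fun j _ ↦ (memLp_greenFn (waveNumber_re_pos hz) (x j)).const_mul (c j)

end Defect

/-! ### The domain of the adjoint in terms of `exp (-r) / r` and `exp (-r)` -/

lemma four_pi_mul_greenFn_one (a y : R3) :
    4 * Real.pi * greenFn 1 a y = ((Real.exp (-‖y - a‖) / ‖y - a‖ : ℝ) : ℂ) := by
  have hpi : (4 * Real.pi : ℂ) ≠ 0 := by simp [Real.pi_ne_zero]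
  rw [greenFn, mul_div_cancel₀ _ hpi, profile]
  push_cast
  rw [neg_one_mul]

lemma memLp_expPart (x : Fin m → R3) (ξ₀ ξ₁ : Fin m → ℂ) : MemLp (expPart x ξ₀ ξ₁) 2 volume := by
  refine memLp_finsetSum _ fun j _ ↦ ?_
  simp only [← four_pi_mul_greenFn_one]
  exact (((memLp_greenFn one_re_pos (x j)).const_mul _).const_mul _).add
    ((memLp_exp_neg_norm_sub (x j)).const_mul _)

/-- The function `exp (-|y - a|)` as a vector of `dom (-Δ)`. -/
noncomputable def expDomain (a : R3) : freeHamiltonian.domain :=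
  ⟨expL2 a, (freeHamiltonian_expL2 a).1⟩

lemma freeHamiltonian_expDomain (a : R3) : freeHamiltonian (expDomain a) =
    (8 * Real.pi : ℂ) • greenL2 one_re_pos a - expL2 a := (freeHamiltonian_expL2 a).2

/-- The resolvent at `-1` maps the Green function to `exp (-r) / (8π)`. -/
lemma freeHamiltonian_add_one_expDomain (a : R3) :
    freeHamiltonian ((8 * Real.pi : ℂ)⁻¹ • expDomain a) +
      (((8 * Real.pi : ℂ)⁻¹ • expDomain a : freeHamiltonian.domain) : L2) =
        greenL2 one_re_pos a := by
  have hpi : (8 * Real.pi : ℂ) ≠ 0 := by simp [Real.pi_ne_zero]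
  rw [LinearPMap.map_smul, Submodule.coe_smul, ← smul_add, freeHamiltonian_expDomain]
  change (8 * Real.pi : ℂ)⁻¹ • (_ - expL2 a + expL2 a) = _
  rw [sub_add_cancel, inv_smul_smul₀ hpi]

lemma freeHamiltonian_sum (ξ : Fin m → ℂ) (x : Fin m → R3) :
    freeHamiltonian (∑ j, ξ j • expDomain (x j)) =
      ∑ j, ξ j • ((8 * Real.pi : ℂ) • greenL2 one_re_pos (x j) - expL2 (x j)) :=
  (map_sum freeHamiltonian.toFun (fun j ↦ ξ j • expDomain (x j)) Finset.univ).trans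
    (Finset.sum_congr rfl fun j _ ↦ by
      rw [← freeHamiltonian_expDomain]
      exact freeHamiltonian.map_smul (ξ j) (expDomain (x j)))

lemma coe_sum_expDomain (ξ : Fin m → ℂ) (x : Fin m → R3) :
    ((∑ j, ξ j • expDomain (x j) : freeHamiltonian.domain) : L2) = ∑ j, ξ j • expL2 (x j) := by
  simp [expDomain]

lemma coeFn_sum_smul_L2 (c : Fin m → ℂ) (F : Fin m → L2) :
    (∑ j, c j • F j : L2) =ᵐ[volume] fun y ↦ ∑ j, c j * F j y := by
  refine (Lp.coeFn_finsetSum _ _).trans ?_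
  have h1 : ∀ᵐ y, ∀ j, (c j • F j : L2) y = c j * F j y := by
    rw [ae_all_iff]
    intro j
    filter_upwards [Lp.coeFn_smul (c j) (F j)] with y e1
    rw [e1, Pi.smul_apply, smul_eq_mul]
  filter_upwards [h1] with y hy
  simp only [Finset.sum_apply, hy]

/-- The decomposition by `expPart` is the decomposition `u + ∑ j, c j • G j` with `c = 4π ξ₀`. -/
lemma ae_eq_expPart_add_iff (x : Fin m → R3) (f fH : L2) (ξ₀ ξ₁ : Fin m → ℂ) :
    (f =ᵐ[volume] fun y ↦ expPart x ξ₀ ξ₁ y + fH y) ↔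
      f = (∑ j, ξ₁ j • expL2 (x j) + fH) +
        ∑ j, (4 * Real.pi * ξ₀ j) • greenL2 one_re_pos (x j) := by
  have h : ((∑ j, ξ₁ j • expL2 (x j) + fH) +
      ∑ j, (4 * Real.pi * ξ₀ j) • greenL2 one_re_pos (x j) : L2) =ᵐ[volume]
        fun y ↦ expPart x ξ₀ ξ₁ y + fH y := by
    have hE : ∀ᵐ y, ∀ j, expL2 (x j) y = ((Real.exp (-‖y - x j‖) : ℝ) : ℂ) :=
      ae_all_iff.mpr fun j ↦ coeFn_expL2 (x j)
    filter_upwards [Lp.coeFn_add (∑ j, ξ₁ j • expL2 (x j) + fH)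
      (∑ j, (4 * Real.pi * ξ₀ j : ℂ) • greenL2 one_re_pos (x j)),
      Lp.coeFn_add (∑ j, ξ₁ j • expL2 (x j)) fH, coeFn_sum_smul_L2 ξ₁ (fun j ↦ expL2 (x j)),
      coeFn_sum_greenL2 (x := x) one_re_pos (fun j ↦ 4 * Real.pi * ξ₀ j), hE] with y e1 e2 e3 e4 e5
    rw [e1, Pi.add_apply, e2, Pi.add_apply, e3, e4, expPart, Finset.sum_add_distrib]
    simp only [e5, ← four_pi_mul_greenFn_one, mul_left_comm (ξ₀ _), mul_assoc]
    ring
  exact ⟨fun hf ↦ Lp.ext (hf.trans h.symm), fun hf ↦ hf ▸ h⟩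

lemma coeFn_expPartImage (x : Fin m → R3) (w : L2) (ξ₀ ξ₁ : Fin m → ℂ) :
    (∑ j, ξ₁ j • ((8 * Real.pi : ℂ) • greenL2 one_re_pos (x j) - expL2 (x j)) + w -
      ∑ j, (4 * Real.pi * ξ₀ j) • greenL2 one_re_pos (x j) : L2) =ᵐ[volume]
        fun y ↦ expPartImage x ξ₀ ξ₁ y + w y := by
  have hE : ∀ᵐ y, ∀ j, ((8 * Real.pi : ℂ) • greenL2 one_re_pos (x j) - expL2 (x j) : L2) y =
      -((Real.exp (-‖y - x j‖) - 2 * Real.exp (-‖y - x j‖) / ‖y - x j‖ : ℝ) : ℂ) := by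
    rw [ae_all_iff]
    intro j
    filter_upwards [Lp.coeFn_sub ((8 * Real.pi : ℂ) • greenL2 one_re_pos (x j)) (expL2 (x j)),
      Lp.coeFn_smul (8 * Real.pi : ℂ) (greenL2 one_re_pos (x j)), coeFn_expL2 (x j),
      coeFn_greenL2 one_re_pos (x j)] with y e1 e2 e3 e4
    have e5 := four_pi_mul_greenFn_one (x j) y
    rw [e1, Pi.sub_apply, e2, Pi.smul_apply, e3, e4, smul_eq_mul]
    push_cast at e5 ⊢
    linear_combination 2 * e5
  filter_upwards [Lp.coeFn_sub
      (∑ j, ξ₁ j • ((8 * Real.pi : ℂ) • greenL2 one_re_pos (x j) - expL2 (x j)) + w)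
      (∑ j, (4 * Real.pi * ξ₀ j : ℂ) • greenL2 one_re_pos (x j)),
    Lp.coeFn_add (∑ j, ξ₁ j • ((8 * Real.pi : ℂ) • greenL2 one_re_pos (x j) - expL2 (x j))) w,
    coeFn_sum_smul_L2 ξ₁ (fun j ↦ (8 * Real.pi : ℂ) • greenL2 one_re_pos (x j) - expL2 (x j)),
    coeFn_sum_greenL2 (x := x) one_re_pos (fun j ↦ 4 * Real.pi * ξ₀ j), hE] with y e1 e2 e3 e4 e5
  rw [e1, Pi.sub_apply, e2, Pi.add_apply, e3, e4, expPartImage, Finset.sum_add_distrib]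
  simp only [e5, ← four_pi_mul_greenFn_one, mul_left_comm (ξ₀ _), mul_assoc, mul_neg,
    Finset.sum_neg_distrib]
  ring

end PointInteraction

open PointInteraction Extension

theorem proposition4p1 {m : ℕ} (x : Fin m → R3) (hx : Function.Injective x) :
    -- (i)
    (Dense ((minimalOperator x).domain : Set L2) ∧
      (minimalOperator x).IsClosed ∧
      (minimalOperator x).IsFormalAdjoint (minimalOperator x) ∧
      deficiencyIndexPlus (minimalOperator x) = m ∧
      deficiencyIndexMinus (minimalOperator x) = m ∧
      ∀ z : ℂ, z ∉ Complex.ofReal '' Set.Ici (0 : ℝ) →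
        (∀ c : Fin m → ℂ, MemLp (defectFunction x z c) 2 volume) ∧
        ∀ f : L2, f ∈ defectSubspace (minimalOperator x) z ↔
          ∃ c : Fin m → ℂ, f =ᵐ[volume] defectFunction x z c) ∧
    -- (ii)
    ((∀ ξ₀ ξ₁ : Fin m → ℂ, MemLp (expPart x ξ₀ ξ₁) 2 volume) ∧
      (∀ f : L2, f ∈ (minimalOperator x)†.domain ↔
        ∃ (ξ₀ ξ₁ : Fin m → ℂ) (fH : (minimalOperator x).domain),
          f =ᵐ[volume] fun y ↦ expPart x ξ₀ ξ₁ y + (fH : L2) y) ∧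
      (∀ (f : (minimalOperator x)†.domain) (ξ₀ ξ₁ : Fin m → ℂ) (fH : (minimalOperator x).domain),
        ((f : L2) =ᵐ[volume] fun y ↦ expPart x ξ₀ ξ₁ y + (fH : L2) y) →
        (minimalOperator x)† f =ᵐ[volume]
          fun y ↦ expPartImage x ξ₀ ξ₁ y + (minimalOperator x fH) y)) ∧
    -- (iii) and (iv)
    (∀ f : (minimalOperator x)†.domain, ∃ g : R3 → ℂ, IsRegularRep x f g) ∧
    ∃ T : BoundaryTriplet (minimalOperator x) (EuclideanSpace ℂ (Fin m)),
      (∀ (f : (minimalOperator x)†.domain) (ξ₀ ξ₁ : Fin m → ℂ) (fH : (minimalOperator x).domain),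
        ((f : L2) =ᵐ[volume] fun y ↦ expPart x ξ₀ ξ₁ y + (fH : L2) y) →
        ∀ g : R3 → ℂ, IsRegularRep x f g → ∀ j : Fin m,
          Tendsto (fun y ↦ 4 * (Real.pi : ℂ) * (g y * (‖y - x j‖ : ℂ))) (𝓝[≠] x j)
            (𝓝 (T.Γ₀ f j)) ∧
          T.Γ₀ f j = 4 * (Real.pi : ℂ) * ξ₀ j ∧
          Tendsto (fun y ↦ g y - ξ₀ j / (‖y - x j‖ : ℂ)) (𝓝[≠] x j) (𝓝 (T.Γ₁ f j))) ∧
      T.A₀ = freeHamiltonian ∧ freeHamiltonian.domain = W22 ∧ IsSelfAdjoint T.A₀ := by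
  have h := isFiniteRestriction_minimalOperator hx
  have hpi : (Real.pi : ℂ) ≠ 0 := by simp [Real.pi_ne_zero]
  -- the part of a vector of `dom H*` that lies in `dom (-Δ)`, with the value of `-Δ` on it
  have hreg : ∀ (ξ₁ : Fin m → ℂ) (fH : (minimalOperator x).domain),
      ∃ u : freeHamiltonian.domain, (u : L2) = ∑ j, ξ₁ j • expL2 (x j) + fH ∧
        freeHamiltonian u = ∑ j, ξ₁ j • ((8 * Real.pi : ℂ) • greenL2 one_re_pos (x j) -
          expL2 (x j)) + minimalOperator x fH := by
    intro ξ₁ fH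
    obtain ⟨v, hv, hv', -⟩ := h.apply_eq fH
    refine ⟨∑ j, ξ₁ j • expDomain (x j) + v, ?_, ?_⟩
    · rw [Submodule.coe_add, coe_sum_expDomain, hv]
    · rw [LinearPMap.map_add, freeHamiltonian_sum, hv']
  refine ⟨⟨h.dense_domain, h.isClosed, h.isFormalAdjoint,
    rank_defectSubspace hx (notMem_of_im_ne_zero (by simp)),
    rank_defectSubspace hx (notMem_of_im_ne_zero (by simp)), fun z hz ↦
      ⟨fun c ↦ memLp_defectFunction hz c, fun f ↦ ?_⟩⟩,
    ⟨memLp_expPart x, fun f ↦ ?_, fun f ξ₀ ξ₁ fH hf ↦ ?_⟩, fun f ↦ ?_,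
    h.boundaryTriplet (greenMatrix x) conj_greenMatrix, fun f ξ₀ ξ₁ fH hf g hg j ↦ ?_,
    h.boundaryTriplet_A₀ _ _, rfl, ?_⟩
  · rw [mem_defectSubspace_iff hx hz]
    exact exists_congr fun c ↦ (ae_eq_defectFunction_iff hz f c).symm
  · rw [h.mem_adjoint_iff]
    constructor
    · rintro ⟨u, c, rfl⟩
      obtain ⟨b, w, hw⟩ := h.exists_sum_add_restrict _
        (fun j ↦ freeHamiltonian_add_one_expDomain (x j)) u
      refine ⟨fun j ↦ c j / (4 * Real.pi), fun j ↦ b j * (8 * Real.pi : ℂ)⁻¹, w,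
        (ae_eq_expPart_add_iff x _ _ _ _).mpr ?_⟩
      rw [hw]
      congr 1
      · congr 1
        refine Finset.sum_congr rfl fun j _ ↦ ?_
        rw [Submodule.coe_smul, smul_smul]
        rfl
      · refine Finset.sum_congr rfl fun j _ ↦ ?_
        congr 1
        field_simp
    · rintro ⟨ξ₀, ξ₁, fH, hf⟩
      obtain ⟨u, hu, -⟩ := hreg ξ₁ fH
      exact ⟨u, fun j ↦ 4 * Real.pi * ξ₀ j, by
        rw [hu, (ae_eq_expPart_add_iff x _ _ _ _).mp hf]⟩
  · obtain ⟨u, hu, hu'⟩ := hreg ξ₁ fH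
    have hf' := (ae_eq_expPart_add_iff x _ _ _ _).mp hf
    rw [← hu] at hf'
    rw [h.adjoint_apply f u _ hf', hu']
    exact coeFn_expPartImage x _ ξ₀ ξ₁
  · obtain ⟨u, c, hf⟩ := (h.mem_adjoint_iff f).mp f.2
    exact ⟨_, isRegularRep_add_sum u.2 one_re_pos c hf⟩
  · obtain ⟨u, hu, -⟩ := hreg ξ₁ fH
    have hf' := (ae_eq_expPart_add_iff x _ _ _ _).mp hf
    rw [← hu] at hf'
    rw [h.boundaryTriplet_Γ₀_apply _ _ f u _ hf', h.boundaryTriplet_Γ₁_apply _ _ f u _ hf',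
      inner_greenL2_one]
    refine ⟨?_, rfl, ?_⟩
    · have h1 := (tendsto_rep_mul_norm hx u.2 one_re_pos _ hf' hg j).const_mul (4 * Real.pi : ℂ)
      convert h1 using 2
      field_simp
    · refine (tendsto_rep_sub hx u.2 _ hf' hg j).congr fun y ↦ ?_
      rw [mul_div_mul_left _ _ (by simp [Real.pi_ne_zero])]
  · rw [h.boundaryTriplet_A₀]
    exact h.isSelfAdjoint
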